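/- Let $\alpha>0$ and $b\in\mathbb R\setminus\{0\}$. In coordinates $(t,\rho,\theta,\varphi)$, $\rho>0$, covering the interior of the cosmological horizon of de Sitter spacetime (the horizon is $\rho\to\infty$), let $$g=\frac{-dt^2+d\rho^2}{\cosh^2(\alpha\rho)}+\alpha^{-2}\tanh^2(\alpha\rho)\,(d\theta^2+\sin^2\theta\,d\varphi^2).$$ Let $\upsilon\in(0,2\pi)$ be given by $\sin\upsilon=\frac{2b\alpha}{1+b^2\alpha^2}$, $\cos\upsilon=\frac{1-b^2\alpha^2}{1+b^2\alpha^2}$, and put $N=\cosh(\alpha\rho)-\cosh(\alpha t-i\upsilon)$, $$\chi=\frac{\alpha^2\sinh^2(\alpha\rho)}{(1+b^2\alpha^2)^2N^2}.$$ The $l=1$ hopfion-like Maxwell field is $$\mathcal F_H=e^{i\varphi}\Big\{2\chi\sin\theta\Big(\tfrac{\alpha^2}{\sinh^2(\alpha\rho)}dt\wedge d\rho+i\sin\theta\,d\theta\wedge d\varphi\Big)-(\partial_t\chi-\partial_\rho\chi\cos\theta)(dt\wedge d\theta-i\sin\theta\,d\rho\wedge d\varphi)-(\partial_\rho\chi-\partial_t\chi\cos\theta)(d\rho\wedge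 d\theta-i\sin\theta\,dt\wedge d\varphi)\Big\}.$$ Let $I=\cosh(\alpha\rho)+\cosh(\alpha t)$, $\cosh u=\frac{1+\cosh(\alpha\rho)\cosh(\alpha t)}{I}$, $\sinh u=\frac{\sinh(\alpha\rho)\sinh(\alpha t)}{I}$, $M=\sin\upsilon\cosh(\alpha\rho)+2i\cos\frac\upsilon2\sinh(\alpha t-\frac{i\upsilon}2)$, $D_1=NM^2$, $D_2=N^2M$, and $$\begin{aligned}\mathcal A_H=&-\frac{\alpha^3I^2e^{i\varphi}\sin\theta}{D_1(1+\alpha^2b^2)^2}\Big\{\Big[i\sin\upsilon\sinh u+(1+\cos\upsilon)\Big(\tfrac{\sinh(\alpha\rho)\cosh u}{I}-\alpha^{-1}\partial_\rho(\cosh u)\Big)\Big]dt\\&\qquad+\Big[-i\sin\upsilon\cosh u+(1+\cos\upsilon)\Big(\tfrac{\sinh(\alpha t)\cosh u}{I}-\alpha^{-1}\partial_t(\cosh u)\Big)\Big]d\rho\Big\}\\&-\frac{\alpha^2e^{i\varphi}\sinh(\alpha\rho)}{D_2(1+\alpha^2b^2)^2}\Big\{\big(I(\cosh u-\cosh(\alpha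 t-i\upsilon))-\cos\upsilon\sinh^2(\alpha\rho)\big)(\sin\theta\,d\varphi-i\cos\theta\,d\theta)\\&\qquad+\sinh(\alpha\rho)\big(\cosh(\alpha\rho)\sin\upsilon+i(\sinh(\alpha t)+\sinh(\alpha t-i\upsilon))\big)(d\theta+i\sin\theta\cos\theta\,d\varphi)\Big\}.\end{aligned}$$ Write $\mathcal F_H=F+iG$, $\mathcal A_H=A+iC$ with real $F,G,A,C$. (The electric and magnetic fields are proportional to $F^{ti}$ and $G^{ti}$, so that in flat space the helicity density below is $(\mathbf A\cdot\mathbf B-\mathbf C\cdot\mathbf E)/8\pi$.) The helicity current is the vector density $$\mathcal C^\mu=\tfrac1{8\pi}\sqrt{|\det g|}\,\big(G^{\mu\nu}A_\nu-F^{\mu\nu}C_\nu\big)=\tfrac1{8\pi}\sqrt{|\det g|}\;\Im\big(\mathcal F_H^{\mu\nu}\,\overline{(\mathcal A_H)_\nu}\big),$$ and the total helicity inside the horizon is $H(t)=\int_0^\infty d\rho\int_0^\pi d\theta\int_0^{2\pi}d\varphi\;\mathcal C^t$. Then: 1. $\mathcal A_H$ is smooth for $\rho>0$, $0<\theta<\pi$,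 and $d\mathcal A_H=\mathcal F_H$ there. 2. For every $t$ the density $\mathcal C^t$ is integrable over $(0,\infty)\times(0,\pi)\times(0,2\pi)$ and $$H(t)=\frac{\alpha^4b^4\arctan\frac1{\alpha b}+2b^2\alpha^2\arctan\frac1{\alpha b}-b^3\alpha^3+\arctan\frac1{\alpha b}+\alpha b}{8b^4(b^2\alpha^2+1)^2};$$ in particular $H$ does not depend on $t$: $dH/dt=0$. 3. The helicity flux through the cosmological horizon vanishes: for every $t$, $\mathcal C^\rho$ is integrable over every sphere $\rho=\mathrm{const}>0$, and $$\lim_{\rho\to\infty}\Big(-\int_0^\pi d\theta\int_0^{2\pi}d\varphi\;\mathcal C^\rho(t,\rho,\theta,\varphi)\Big)=0.$$ 4. For every fixed $t$, as $\alpha\to0^+$, $H\to\dfrac{\pi\,\operatorname{sign}(b)}{16\,b^4}$, and more precisely $H=\dfrac{\pi\,\operatorname{sign}(b)}{16\,b^4}+O(\alpha^3)$. -/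

import Mathlib

open Real Set Filter Topology MeasureTheory Asymptotics
open scoped ContDiff

noncomputable section

namespace DeSitterHopfion

/-! Coordinates `x = (t, ρ, θ, φ)` on the region of de Sitter spacetime inside the cosmological
horizon are indexed by `Fin 4`; the horizon `r = 1/α` corresponds to `ρ → ∞`, where
`r = tanh (α ρ) / α`. -/

/-- The coordinate domain `ρ > 0`, `0 < θ < π`. -/
def chart : Set (Fin 4 → ℝ) := {x | 0 < x 1 ∧ 0 < x 2 ∧ x 2 < π}

/-- `g = - dt² / cosh² (α ρ) + dρ² / cosh² (α ρ) + α⁻² tanh² (α ρ) (dθ² + sin² θ dφ²)`. -/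
def metric (α : ℝ) (x : Fin 4 → ℝ) : Matrix (Fin 4) (Fin 4) ℝ :=
  Matrix.diagonal ![-1 / cosh (α * x 1) ^ 2, 1 / cosh (α * x 1) ^ 2,
    tanh (α * x 1) ^ 2 / α ^ 2, tanh (α * x 1) ^ 2 / α ^ 2 * sin (x 2) ^ 2]

/-- `√|det g|`. -/
def volumeFactor (α : ℝ) (x : Fin 4 → ℝ) : ℝ := √|(metric α x).det|

/-- `W^{μν} = g^{μκ} g^{νλ} W_{κλ}`. -/
def raise (α : ℝ) (x : Fin 4 → ℝ) (W : Matrix (Fin 4) (Fin 4) ℂ) (μ ν : Fin 4) : ℂ :=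
  ∑ κ, ∑ l, (((metric α x)⁻¹ μ κ * (metric α x)⁻¹ ν l : ℝ) : ℂ) * W κ l

/-- The partial derivative `∂_μ f`. -/
def partialDeriv (μ : Fin 4) (f : (Fin 4 → ℝ) → ℂ) (x : Fin 4 → ℝ) : ℂ :=
  deriv (fun s : ℝ => f (Function.update x μ s)) (x μ)

/-- The exterior derivative of a one-form, `(d𝓐)_{μν} = ∂_μ 𝓐_ν - ∂_ν 𝓐_μ`. -/
def extD (A : (Fin 4 → ℝ) → Fin 4 → ℂ) (x : Fin 4 → ℝ) : Matrix (Fin 4) (Fin 4) ℂ :=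
  fun μ ν => partialDeriv μ (fun y => A y ν) x - partialDeriv ν (fun y => A y μ) x

/-- The angle `υ ∈ (0, 2π)` with `sin υ = 2 b α / (1 + b² α²)` and
`cos υ = (1 - b² α²) / (1 + b² α²)`; see `upsilon_spec`. -/
def upsilon (α b : ℝ) : ℝ := π - 2 * arctan (1 / (α * b))

theorem upsilon_spec (α b : ℝ) (h : α * b ≠ 0) :
    0 < upsilon α b ∧ upsilon α b < 2 * π ∧
      sin (upsilon α b) = 2 * b * α / (1 + b ^ 2 * α ^ 2) ∧
      cos (upsilon α b) = (1 - b ^ 2 * α ^ 2) / (1 + b ^ 2 * α ^ 2) := by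
  have h1 := arctan_lt_pi_div_two (1 / (α * b))
  have h2 := neg_pi_div_two_lt_arctan (1 / (α * b))
  have hα : α ≠ 0 := left_ne_zero_of_mul h
  have hb : b ≠ 0 := right_ne_zero_of_mul h
  have hc : cos (arctan (1 / (α * b))) ^ 2 = 1 / (1 + (1 / (α * b)) ^ 2) := cos_sq_arctan _
  have hs : sin (arctan (1 / (α * b))) = 1 / (α * b) * cos (arctan (1 / (α * b))) := by
    have h3 : tan (arctan (1 / (α * b))) = 1 / (α * b) := tan_arctan _
    have h4 : cos (arctan (1 / (α * b))) ≠ 0 := (cos_arctan_pos _).ne'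
    rw [tan_eq_sin_div_cos, div_eq_iff h4] at h3
    exact h3
  have hp : 1 + b ^ 2 * α ^ 2 ≠ 0 := by positivity
  have hq : 1 + (1 / (α * b)) ^ 2 ≠ 0 := by positivity
  refine ⟨by unfold upsilon; linarith, by unfold upsilon; linarith, ?_, ?_⟩
  · rw [upsilon, sin_pi_sub, sin_two_mul, hs,
      show 2 * (1 / (α * b) * cos (arctan (1 / (α * b)))) * cos (arctan (1 / (α * b)))
        = 2 / (α * b) * cos (arctan (1 / (α * b))) ^ 2 by ring, hc]
    field_simp
    ring
  · rw [upsilon, cos_pi_sub, cos_two_mul, hc]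
    field_simp
    ring

/-- `N = cosh (α ρ) - cosh (α t - i υ)`. -/
def nFun (α b t ρ : ℝ) : ℂ :=
  Complex.cosh (α * ρ) - Complex.cosh (α * t - Complex.I * upsilon α b)

/-- `χ = α² sinh² (α ρ) / ((1 + b² α²)² (cosh (α ρ) - cosh (α t - i υ))²)`. -/
def chi (α b t ρ : ℝ) : ℂ :=
  (α : ℂ) ^ 2 * Complex.sinh (α * ρ) ^ 2 / ((1 + (b : ℂ) ^ 2 * α ^ 2) ^ 2 * nFun α b t ρ ^ 2)

/-- `∂_t χ`. -/
def chiT (α b t ρ : ℝ) : ℂ := deriv (fun s : ℝ => chi α b s ρ) t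

/-- `∂_ρ χ`. -/
def chiR (α b t ρ : ℝ) : ℂ := deriv (fun s : ℝ => chi α b t s) ρ

/-- The two-form `dx^μ ∧ dx^ν`. -/
def wedge (μ ν : Fin 4) : Matrix (Fin 4) (Fin 4) ℂ :=
  Matrix.single μ ν 1 - Matrix.single ν μ 1

/-- The complex Maxwell two-form `𝓕_H` of the hopfion-like solution with `l = 1`. -/
def hopfionF (α b : ℝ) (x : Fin 4 → ℝ) : Matrix (Fin 4) (Fin 4) ℂ :=
  let χ := chi α b (x 0) (x 1)
  let χt := chiT α b (x 0) (x 1)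
  let χr := chiR α b (x 0) (x 1)
  let S : ℂ := Complex.sin (x 2)
  let C : ℂ := Complex.cos (x 2)
  Complex.exp (Complex.I * x 3) •
    ((2 * χ * S) • (((α : ℂ) ^ 2 / Complex.sinh (α * x 1) ^ 2) • wedge 0 1
        + (Complex.I * S) • wedge 2 3)
      - (χt - χr * C) • (wedge 0 2 - (Complex.I * S) • wedge 1 3)
      - (χr - χt * C) • (wedge 1 2 - (Complex.I * S) • wedge 0 3))

/-- `I = cosh (α ρ) + cosh (α t)`. -/
def sumCosh (α t ρ : ℝ) : ℝ := cosh (α * ρ) + cosh (α * t)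

/-- `cosh u`, where `u = u (t, ρ)`. -/
def coshU (α t ρ : ℝ) : ℝ := (1 + cosh (α * ρ) * cosh (α * t)) / sumCosh α t ρ

/-- `sinh u`, where `u = u (t, ρ)`. -/
def sinhU (α t ρ : ℝ) : ℝ := sinh (α * ρ) * sinh (α * t) / sumCosh α t ρ

/-- `M = sin υ cosh (α ρ) + 2 i cos (υ / 2) sinh (α t - i υ / 2)`. -/
def mFun (α b t ρ : ℝ) : ℂ :=
  Complex.sin (upsilon α b) * Complex.cosh (α * ρ)
    + 2 * Complex.I * Complex.cos (upsilon α b / 2)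
      * Complex.sinh (α * t - Complex.I * upsilon α b / 2)

/-- `D₁ = N M²`. -/
def D1 (α b t ρ : ℝ) : ℂ := nFun α b t ρ * mFun α b t ρ ^ 2

/-- `D₂ = N² M`. -/
def D2 (α b t ρ : ℝ) : ℂ := nFun α b t ρ ^ 2 * mFun α b t ρ

/-- The common factor of the `dt` and `dρ` components of the potential. -/
def factor1 (α b : ℝ) (x : Fin 4 → ℝ) : ℂ :=
  -((α : ℂ) ^ 3 * (sumCosh α (x 0) (x 1) : ℂ) ^ 2 * Complex.exp (Complex.I * x 3)
      * Complex.sin (x 2))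
    / (D1 α b (x 0) (x 1) * (1 + (α : ℂ) ^ 2 * b ^ 2) ^ 2)

/-- The common factor of the `dθ` and `dφ` components of the potential. -/
def factor2 (α b : ℝ) (x : Fin 4 → ℝ) : ℂ :=
  -((α : ℂ) ^ 2 * Complex.exp (Complex.I * x 3) * Complex.sinh (α * x 1))
    / (D2 α b (x 0) (x 1) * (1 + (α : ℂ) ^ 2 * b ^ 2) ^ 2)

/-- The bracket multiplying `dt`. -/
def bracketT (α b t ρ : ℝ) : ℂ :=
  Complex.I * Complex.sin (upsilon α b) * sinhU α t ρ
    + (1 + Complex.cos (upsilon α b))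
      * ((sinh (α * ρ) * coshU α t ρ / sumCosh α t ρ
          - α⁻¹ * deriv (fun s => coshU α t s) ρ : ℝ) : ℂ)

/-- The bracket multiplying `dρ`. -/
def bracketR (α b t ρ : ℝ) : ℂ :=
  -Complex.I * Complex.sin (upsilon α b) * coshU α t ρ
    + (1 + Complex.cos (upsilon α b))
      * ((sinh (α * t) * coshU α t ρ / sumCosh α t ρ
          - α⁻¹ * deriv (fun s => coshU α s ρ) t : ℝ) : ℂ)

/-- The coefficient of `sin θ dφ - i cos θ dθ`. -/
def bracketX (α b t ρ : ℝ) : ℂ :=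
  sumCosh α t ρ * (coshU α t ρ - Complex.cosh (α * t - Complex.I * upsilon α b))
    - Complex.cos (upsilon α b) * Complex.sinh (α * ρ) ^ 2

/-- The coefficient of `dθ + i sin θ cos θ dφ`. -/
def bracketY (α b t ρ : ℝ) : ℂ :=
  Complex.sinh (α * ρ) * (Complex.cosh (α * ρ) * Complex.sin (upsilon α b)
    + Complex.I * (Complex.sinh (α * t) + Complex.sinh (α * t - Complex.I * upsilon α b)))

/-- The potential one-form `𝓐_H`. -/
def hopfionA (α b : ℝ) (x : Fin 4 → ℝ) : Fin 4 → ℂ :=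
  let S : ℂ := Complex.sin (x 2)
  let C : ℂ := Complex.cos (x 2)
  let X := bracketX α b (x 0) (x 1)
  let Y := bracketY α b (x 0) (x 1)
  ![factor1 α b x * bracketT α b (x 0) (x 1),
    factor1 α b x * bracketR α b (x 0) (x 1),
    factor2 α b x * (X * (-Complex.I * C) + Y),
    factor2 α b x * (X * S + Y * (Complex.I * S * C))]

/-- The helicity current (a vector density)
`(1 / 8π) √|det g| (G^{μν} A_ν - F^{μν} C_ν)` of the complex field `F + i G` with the complex
potential `A + i C`. The electric and magnetic fields are `E^i ∝ F^{ti}` and `B^i ∝ G^{ti}`, that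
is, the field is the one with Riemann-Silberstein vector `E + i B`, and in flat spacetime the time
component of the current is `(A · B - C · E) / 8π`. -/
def helicityCurrent (α : ℝ) (F : (Fin 4 → ℝ) → Matrix (Fin 4) (Fin 4) ℂ)
    (A : (Fin 4 → ℝ) → Fin 4 → ℂ) (x : Fin 4 → ℝ) (μ : Fin 4) : ℝ :=
  1 / (8 * π) * volumeFactor α x *
    ∑ ν, ((raise α x (F x) μ ν).im * (A x ν).re - (raise α x (F x) μ ν).re * (A x ν).im)

/-- The helicity current of the hopfion-like solution. -/
def hopfionCurrent (α b t ρ θ φ : ℝ) (μ : Fin 4) : ℝ :=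
  helicityCurrent α (hopfionF α b) (hopfionA α b) ![t, ρ, θ, φ] μ

/-- The total helicity at time `t` inside the cosmological horizon. -/
def totalHelicity (α b t : ℝ) : ℝ :=
  ∫ ρ in Ioi (0 : ℝ), ∫ θ in (0 : ℝ)..π, ∫ φ in (0 : ℝ)..(2 * π), hopfionCurrent α b t ρ θ φ 0

/-- The helicity flux into the ball bounded by the sphere of radius `ρ`, at time `t`. -/
def helicityFlux (α b t ρ : ℝ) : ℝ :=
  -∫ θ in (0 : ℝ)..π, ∫ φ in (0 : ℝ)..(2 * π), hopfionCurrent α b t ρ θ φ 1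

/-- The closed form of the total helicity. -/
def helicityValue (α b : ℝ) : ℝ :=
  (α ^ 4 * b ^ 4 * arctan (1 / (α * b)) + 2 * b ^ 2 * α ^ 2 * arctan (1 / (α * b))
      - b ^ 3 * α ^ 3 + arctan (1 / (α * b)) + α * b)
    / (8 * b ^ 4 * (b ^ 2 * α ^ 2 + 1) ^ 2)

end DeSitterHopfion

end

/-!
In the null coordinates `v = tanh (α (t + ρ) / 2)` and `u = tanh (α (t - ρ) / 2)` the chart becomes
conformally flat, and with `q = b α` all coefficients of the field and of the potential are rational
functions of `q + i v` and `q + i u`; both `d𝓐 = 𝓕` and the helicity current are then rational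
computations.

Averaged over the spheres `ρ = const`, the helicity current is proportional to the differential of
an explicit function of `(v, u)` that vanishes on the axis `v = u`. Besides a rational term it
contains the antiderivative of `sin ^ 4`, evaluated at the phase difference of `q + i v` and
`q + i u`, which is where the arctangent in the helicity comes from. On every slice `t = const` the
horizon is the same corner `(v, u) = (1, -1)`, so the total helicity is the value of that function
there, whatever `t` is. Integrability and vanishing of the horizon flux hold because the current is
a function continuous on the compact square `[-1, 1]²` times `dv / dt` or `du / dt`, which are
integrable and tend to zero.
-/

namespace DeSitterHopfion

noncomputable section

/-- The conformally flat null coordinate `tanh (α s / 2)` attached to `s = t + ρ` or `s = t - ρ`. -/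
def nullCoord (α s : ℝ) : ℝ := tanh (α * s / 2)

/-- The derivative of `nullCoord α`. -/
def nullDeriv (α s : ℝ) : ℝ := α / 2 * (1 - nullCoord α s ^ 2)

section NullCoord

theorem hasDerivAt_nullCoord (α s : ℝ) : HasDerivAt (nullCoord α) (nullDeriv α s) s := by
  have hc := (cosh_pos (α * s / 2)).ne'
  have harg : HasDerivAt (fun s => α * s / 2) (α / 2) s := by
    simpa using ((hasDerivAt_id s).const_mul α).div_const 2
  have hquot := harg.sinh.div harg.cosh hc
  refine (hquot.congr_deriv ?_).congr_of_eventuallyEq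
    (Eventually.of_forall fun s => tanh_eq_sinh_div_cosh (α * s / 2))
  rw [nullDeriv, nullCoord, tanh_eq_sinh_div_cosh]
  field_simp

theorem contDiff_nullCoord (α : ℝ) {n : WithTop ℕ∞} : ContDiff ℝ n (nullCoord α) := by
  unfold nullCoord
  simp only [tanh_eq_sinh_div_cosh]
  exact ContDiff.div (by fun_prop) (by fun_prop) fun s => (cosh_pos _).ne'

theorem contDiff_nullDeriv (α : ℝ) {n : WithTop ℕ∞} : ContDiff ℝ n (nullDeriv α) :=
  contDiff_const.mul (contDiff_const.sub ((contDiff_nullCoord α).pow 2))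

theorem hasDerivAt_nullDeriv (α s : ℝ) :
    HasDerivAt (nullDeriv α) (-(α * nullCoord α s * nullDeriv α s)) s := by
  refine ((((hasDerivAt_nullCoord α s).pow 2).const_sub 1).const_mul (α / 2)).congr_deriv ?_
  norm_num
  ring

theorem nullCoord_neg (α s : ℝ) : nullCoord α (-s) = -nullCoord α s := by
  rw [nullCoord, nullCoord, ← tanh_neg]
  ring_nf

theorem nullDeriv_neg (α s : ℝ) : nullDeriv α (-s) = nullDeriv α s := by
  rw [nullDeriv, nullDeriv, nullCoord_neg, neg_sq]

theorem nullCoord_mem_Ioo (α s : ℝ) : nullCoord α s ∈ Ioo (-1 : ℝ) 1 :=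
  tanh_bijOn.mapsTo (mem_univ _)

theorem nullDeriv_nonneg {α : ℝ} (hα : 0 ≤ α) (s : ℝ) : 0 ≤ nullDeriv α s := by
  obtain ⟨hlo, hhi⟩ := nullCoord_mem_Ioo α s
  exact mul_nonneg (by positivity) (by nlinarith)

theorem tendsto_tanh_atTop : Tendsto tanh atTop (𝓝 1) :=
  tendsto_order.2 ⟨fun y hy => by
    filter_upwards [eventually_gt_atTop (artanh (max y 0))] with x hx
    by_contra! hle
    have hartanh := artanh_le_artanh (neg_one_lt_tanh x) (max_lt hy one_pos)
      (hle.trans (le_max_left y 0))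
    rw [artanh_tanh] at hartanh
    exact hx.not_ge hartanh,
    fun y hy => Eventually.of_forall fun x => (tanh_lt_one x).trans hy⟩

theorem tendsto_nullCoord_atTop {α : ℝ} (hα : 0 < α) : Tendsto (nullCoord α) atTop (𝓝 1) :=
  tendsto_tanh_atTop.comp ((tendsto_id.const_mul_atTop hα).atTop_div_const two_pos)

theorem tendsto_nullCoord_atBot {α : ℝ} (hα : 0 < α) : Tendsto (nullCoord α) atBot (𝓝 (-1)) := by
  simpa [Function.comp_def, nullCoord_neg] using
    ((tendsto_nullCoord_atTop hα).comp tendsto_neg_atBot_atTop).neg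

theorem tendsto_nullDeriv_atTop {α : ℝ} (hα : 0 < α) : Tendsto (nullDeriv α) atTop (𝓝 0) := by
  simpa [funext (nullDeriv.eq_1 α)] using
    (((tendsto_nullCoord_atTop hα).pow 2).const_sub 1).const_mul (α / 2)

theorem tendsto_nullDeriv_atBot {α : ℝ} (hα : 0 < α) : Tendsto (nullDeriv α) atBot (𝓝 0) := by
  simpa [funext (nullDeriv.eq_1 α)] using
    (((tendsto_nullCoord_atBot hα).pow 2).const_sub 1).const_mul (α / 2)

theorem integrableOn_nullDeriv_add {α : ℝ} (hα : 0 < α) (t a : ℝ) :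
    IntegrableOn (fun ρ => nullDeriv α (t + ρ)) (Ioi a) :=
  integrableOn_Ioi_deriv_of_nonneg' (fun ρ _ => (hasDerivAt_nullCoord α (t + ρ)).comp_const_add t ρ)
    (fun ρ _ => nullDeriv_nonneg hα.le (t + ρ))
    ((tendsto_nullCoord_atTop hα).comp (tendsto_atTop_add_const_left _ t tendsto_id))

theorem integrableOn_nullDeriv_sub {α : ℝ} (hα : 0 < α) (t a : ℝ) :
    IntegrableOn (fun ρ => nullDeriv α (t - ρ)) (Ioi a) := by
  have hreflect (ρ : ℝ) : nullDeriv α (t - ρ) = nullDeriv α (-t + ρ) := by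
    rw [← nullDeriv_neg]
    ring_nf
  simpa only [hreflect] using integrableOn_nullDeriv_add hα (-t) a

end NullCoord

/-- The linear function `q + i w` of a null coordinate `w`, in which field and potential are
rational; it stands for the complexified null coordinate of the conformally flat chart. -/
def pole (q w : ℝ) : ℂ := q + Complex.I * w

/-- The hopfion scalar `χ / α²` in null coordinates, with `q = b α`. -/
def nullChi (q v u : ℝ) : ℂ := -(1 / 4) * (1 / pole q u - 1 / pole q v) ^ 2

/-- The partial derivative of `nullChi q` in its first argument. -/
def nullChiDeriv (q v u : ℝ) : ℂ :=
  -(Complex.I / 2) * (1 / pole q u - 1 / pole q v) / pole q v ^ 2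

/-- The null components of the potential: up to the factor `α² e^{iφ} sin θ`, the `dv` component
is `nullPotential q v u` and the `du` component is `-nullPotential q u v`. -/
def nullPotential (q v u : ℝ) : ℂ := Complex.I / (pole q u * (pole q v + pole q u) ^ 2)

/-- The coefficient, up to the factor `α² e^{iφ}`, of `sin θ dφ - i cos θ dθ` in the potential. -/
def anglePotential (q v u : ℝ) : ℂ :=
  Complex.I * (pole q v - pole q u) * (pole q v ^ 2 + pole q u ^ 2)
    / (4 * pole q v ^ 2 * pole q u ^ 2 * (pole q v + pole q u))

section NullFunctions

variable {q : ℝ}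

theorem pole_ne_zero (hq : q ≠ 0) (w : ℝ) : pole q w ≠ 0 := fun h =>
  hq (by simpa [pole] using congrArg Complex.re h)

theorem pole_add_pole_ne_zero (hq : q ≠ 0) (v u : ℝ) : pole q v + pole q u ≠ 0 := fun h =>
  hq (by simpa [pole, ← two_mul] using congrArg Complex.re h)

theorem nullChi_comm (q v u : ℝ) : nullChi q u v = nullChi q v u := by
  unfold nullChi
  ring

theorem anglePotential_comm (q v u : ℝ) : anglePotential q u v = -anglePotential q v u := by
  rw [anglePotential, anglePotential, add_comm (pole q v) (pole q u)]
  ring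

theorem nullChi_eq_div (hq : q ≠ 0) (v u : ℝ) :
    nullChi q v u = (((v - u) / 2 : ℝ) : ℂ) ^ 2 / (pole q v * pole q u) ^ 2 := by
  have hv := pole_ne_zero hq v
  have hu := pole_ne_zero hq u
  have hdiff : 1 / pole q u - 1 / pole q v = Complex.I * (v - u) / (pole q v * pole q u) := by
    field_simp
    unfold pole
    ring
  rw [nullChi, hdiff, div_pow, mul_pow, Complex.I_sq]
  push_cast
  ring

section Derivatives

variable {v u : ℝ → ℝ} {v' u' s : ℝ}

theorem hasDerivAt_pole (q : ℝ) (hv : HasDerivAt v v' s) :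
    HasDerivAt (fun s => pole q (v s)) (Complex.I * v') s :=
  (hv.ofReal_comp.const_mul Complex.I).const_add (q : ℂ)

theorem hasDerivAt_nullChi (hq : q ≠ 0) (hv : HasDerivAt v v' s) (hu : HasDerivAt u u' s) :
    HasDerivAt (fun s => nullChi q (v s) (u s))
      (nullChiDeriv q (v s) (u s) * v' + nullChiDeriv q (u s) (v s) * u') s := by
  have ha := pole_ne_zero hq (v s)
  have hb := pole_ne_zero hq (u s)
  have hinv := ((hasDerivAt_const s (1 : ℂ)).div (hasDerivAt_pole q hu) hb).sub
    ((hasDerivAt_const s (1 : ℂ)).div (hasDerivAt_pole q hv) ha)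
  refine ((hinv.pow 2).const_mul (-(1 / 4))).congr_deriv ?_
  simp only [nullChiDeriv, Pi.sub_apply, Pi.div_apply, Nat.cast_ofNat, Nat.reduceSub, pow_one]
  field_simp
  ring

theorem hasDerivAt_nullPotential (hq : q ≠ 0) (hv : HasDerivAt v v' s) (hu : HasDerivAt u u' s) :
    HasDerivAt (fun s => nullPotential q (v s) (u s))
      (2 / (pole q (u s) * (pole q (v s) + pole q (u s)) ^ 3) * (v' + u')
        + 1 / (pole q (u s) ^ 2 * (pole q (v s) + pole q (u s)) ^ 2) * u') s := by
  have hb := pole_ne_zero hq (u s)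
  have hab := pole_add_pole_ne_zero hq (v s) (u s)
  have hden := (hasDerivAt_pole q hu).mul
    (((hasDerivAt_pole q hv).add (hasDerivAt_pole q hu)).pow 2)
  refine ((hasDerivAt_const s Complex.I).div hden
    (mul_ne_zero hb (pow_ne_zero 2 hab))).congr_deriv ?_
  simp only [Pi.mul_apply, Pi.pow_apply, Pi.add_apply, Nat.cast_ofNat]
  field_simp
  simp only [Complex.I_sq]
  ring

theorem hasDerivAt_anglePotential (hq : q ≠ 0) (hv : HasDerivAt v v' s)
    (hu : HasDerivAt u u' s) :
    HasDerivAt (fun s => anglePotential q (v s) (u s))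
      (Complex.I * (nullPotential q (v s) (u s) + nullChiDeriv q (v s) (u s)) * v'
        - Complex.I * (nullPotential q (u s) (v s) + nullChiDeriv q (u s) (v s)) * u') s := by
  have ha := pole_ne_zero hq (v s)
  have hb := pole_ne_zero hq (u s)
  have hab := pole_add_pole_ne_zero hq (v s) (u s)
  have hnum := (((hasDerivAt_pole q hv).sub (hasDerivAt_pole q hu)).const_mul Complex.I).mul
    (((hasDerivAt_pole q hv).pow 2).add ((hasDerivAt_pole q hu).pow 2))
  have hden := ((((hasDerivAt_pole q hv).pow 2).const_mul 4).mul ((hasDerivAt_pole q hu).pow 2)).mul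
    ((hasDerivAt_pole q hv).add (hasDerivAt_pole q hu))
  have hden_ne : 4 * pole q (v s) ^ 2 * pole q (u s) ^ 2 * (pole q (v s) + pole q (u s)) ≠ 0 := by
    simp [ha, hb, hab]
  refine (hnum.div hden hden_ne).congr_deriv ?_
  simp only [nullPotential, nullChiDeriv, Pi.mul_apply, Pi.pow_apply, Pi.add_apply, Pi.sub_apply,
    Nat.cast_ofNat]
  rw [add_comm (pole q (u s)) (pole q (v s))]
  field_simp
  ring

end Derivatives

section Smoothness

variable {E : Type*} [NormedAddCommGroup E] [NormedSpace ℝ E] {v u : E → ℝ} {n : WithTop ℕ∞}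

@[fun_prop]
theorem contDiff_pole (q : ℝ) (hv : ContDiff ℝ n v) : ContDiff ℝ n fun x => pole q (v x) :=
  contDiff_const.add (contDiff_const.mul (Complex.ofRealCLM.contDiff.comp hv))

theorem contDiff_nullChi (hq : q ≠ 0) (hv : ContDiff ℝ n v) (hu : ContDiff ℝ n u) :
    ContDiff ℝ n fun x => nullChi q (v x) (u x) := by
  simp only [nullChi, div_eq_mul_inv]
  fun_prop (disch := simp [pole_ne_zero hq])

theorem contDiff_nullChiDeriv (hq : q ≠ 0) (hv : ContDiff ℝ n v) (hu : ContDiff ℝ n u) :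
    ContDiff ℝ n fun x => nullChiDeriv q (v x) (u x) := by
  simp only [nullChiDeriv, div_eq_mul_inv]
  fun_prop (disch := simp [pole_ne_zero hq])

theorem contDiff_nullPotential (hq : q ≠ 0) (hv : ContDiff ℝ n v) (hu : ContDiff ℝ n u) :
    ContDiff ℝ n fun x => nullPotential q (v x) (u x) := by
  simp only [nullPotential, div_eq_mul_inv]
  fun_prop (disch := simp [pole_ne_zero hq, pole_add_pole_ne_zero hq])

theorem contDiff_anglePotential (hq : q ≠ 0) (hv : ContDiff ℝ n v) (hu : ContDiff ℝ n u) :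
    ContDiff ℝ n fun x => anglePotential q (v x) (u x) := by
  simp only [anglePotential, div_eq_mul_inv]
  fun_prop (disch := simp [pole_ne_zero hq, pole_add_pole_ne_zero hq])

end Smoothness

end NullFunctions

section NullForm

theorem sumCosh_pos (α t ρ : ℝ) : 0 < sumCosh α t ρ :=
  add_pos (cosh_pos _) (cosh_pos _)

theorem nullCoord_add (α t ρ : ℝ) :
    nullCoord α (t + ρ) = (sinh (α * t) + sinh (α * ρ)) / sumCosh α t ρ := by
  have hp := (cosh_pos (α * (t + ρ) / 2)).ne'
  have hm := (cosh_pos (α * (t - ρ) / 2)).ne'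
  rw [nullCoord, sumCosh, show α * t = α * (t + ρ) / 2 + α * (t - ρ) / 2 by ring,
    show α * ρ = α * (t + ρ) / 2 - α * (t - ρ) / 2 by ring, tanh_eq_sinh_div_cosh, sinh_add,
    sinh_sub, cosh_add, cosh_sub]
  field_simp
  ring

theorem nullCoord_sub (α t ρ : ℝ) :
    nullCoord α (t - ρ) = (sinh (α * t) - sinh (α * ρ)) / sumCosh α t ρ := by
  simpa [sumCosh, sub_eq_add_neg] using nullCoord_add α t (-ρ)

theorem nullDeriv_add (α t ρ : ℝ) :
    nullDeriv α (t + ρ) = α * (coshU α t ρ - sinhU α t ρ) / sumCosh α t ρ := by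
  have hI := (sumCosh_pos α t ρ).ne'
  rw [nullDeriv, nullCoord_add, coshU, sinhU]
  field_simp
  rw [sumCosh]
  linear_combination α * (cosh_sq (α * t) + cosh_sq (α * ρ))

theorem nullDeriv_sub (α t ρ : ℝ) :
    nullDeriv α (t - ρ) = α * (coshU α t ρ + sinhU α t ρ) / sumCosh α t ρ := by
  simpa [sumCosh, coshU, sinhU, sub_eq_add_neg, neg_div] using nullDeriv_add α t (-ρ)

theorem nullDeriv_mul_nullDeriv (α t ρ : ℝ) :
    nullDeriv α (t + ρ) * nullDeriv α (t - ρ) * sinh (α * ρ) ^ 2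
      = α ^ 2 * ((nullCoord α (t + ρ) - nullCoord α (t - ρ)) / 2) ^ 2 := by
  have hI := (sumCosh_pos α t ρ).ne'
  rw [nullDeriv_add, nullDeriv_sub, nullCoord_add, nullCoord_sub, coshU, sinhU]
  field_simp
  rw [sumCosh]
  linear_combination 4 * α ^ 2 * sinh (α * ρ) ^ 2
    * ((cosh (α * ρ) ^ 2 - 1) * cosh_sq (α * t) + sinh (α * t) ^ 2 * cosh_sq (α * ρ))

theorem hasDerivAt_coshU (α t ρ : ℝ) :
    HasDerivAt (fun r => coshU α t r) (α * (sinhU α t ρ * sinh (α * t)) / sumCosh α t ρ) ρ := by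
  have hI := (sumCosh_pos α t ρ).ne'
  have hcosh : HasDerivAt (fun r => cosh (α * r)) (sinh (α * ρ) * α) ρ := by
    simpa using ((hasDerivAt_id ρ).const_mul α).cosh
  refine (((hcosh.mul_const (cosh (α * t))).const_add 1).div
    (hcosh.add_const (cosh (α * t))) hI).congr_deriv ?_
  rw [← sumCosh, sinhU]
  field_simp
  rw [sumCosh]
  linear_combination α * sinh (α * ρ) * cosh_sq (α * t)

theorem coshU_comm (α t ρ : ℝ) : coshU α t ρ = coshU α ρ t := by
  simp only [coshU, sumCosh, add_comm, mul_comm]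

theorem deriv_coshU_rho (α t ρ : ℝ) : deriv (fun r => coshU α t r) ρ
    = α * (sinhU α t ρ * sinh (α * t)) / sumCosh α t ρ :=
  (hasDerivAt_coshU α t ρ).deriv

theorem deriv_coshU_t (α t ρ : ℝ) : deriv (fun s => coshU α s ρ) t
    = α * (sinhU α t ρ * sinh (α * ρ)) / sumCosh α t ρ := by
  simp only [coshU_comm α _ ρ, deriv_coshU_rho, sinhU, sumCosh, add_comm, mul_comm]

theorem one_add_sq_ne_zero (q : ℝ) : 1 + (q : ℂ) ^ 2 ≠ 0 := by
  exact_mod_cast (by positivity : (1 + q ^ 2 : ℝ) ≠ 0)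

theorem pole_nullCoord_add (α q t ρ : ℝ) : pole q (nullCoord α (t + ρ))
    = q + Complex.I * (Complex.sinh (α * t) + Complex.sinh (α * ρ)) / sumCosh α t ρ := by
  rw [pole, nullCoord_add]
  push_cast
  ring

theorem pole_nullCoord_sub (α q t ρ : ℝ) : pole q (nullCoord α (t - ρ))
    = q + Complex.I * (Complex.sinh (α * t) - Complex.sinh (α * ρ)) / sumCosh α t ρ := by
  rw [pole, nullCoord_sub]
  push_cast
  ring

theorem complex_sinh_eq (α q t ρ : ℝ) : Complex.sinh (α * ρ)
    = sumCosh α t ρ * (pole q (nullCoord α (t + ρ)) - pole q (nullCoord α (t - ρ)))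
      / (2 * Complex.I) := by
  have hI : (sumCosh α t ρ : ℂ) ≠ 0 := by exact_mod_cast (sumCosh_pos α t ρ).ne'
  rw [pole_nullCoord_add, pole_nullCoord_sub]
  field_simp
  ring

section Upsilon

variable {α b : ℝ}

theorem complex_sin_upsilon (h : α * b ≠ 0) :
    Complex.sin (upsilon α b) = 2 * ((b * α : ℝ) : ℂ) / (1 + ((b * α : ℝ) : ℂ) ^ 2) := by
  rw [← Complex.ofReal_sin, (upsilon_spec α b h).2.2.1]
  push_cast
  ring_nf

theorem complex_cos_upsilon (h : α * b ≠ 0) : Complex.cos (upsilon α b)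
    = (1 - ((b * α : ℝ) : ℂ) ^ 2) / (1 + ((b * α : ℝ) : ℂ) ^ 2) := by
  rw [← Complex.ofReal_cos, (upsilon_spec α b h).2.2.2]
  push_cast
  ring_nf

theorem cosh_sub_I_mul (z w : ℂ) : Complex.cosh (z - Complex.I * w)
    = Complex.cos w * Complex.cosh z - Complex.I * Complex.sin w * Complex.sinh z := by
  rw [Complex.cosh_sub, mul_comm Complex.I, Complex.cosh_mul_I, Complex.sinh_mul_I]
  ring

theorem sinh_sub_I_mul (z w : ℂ) : Complex.sinh (z - Complex.I * w)
    = Complex.cos w * Complex.sinh z - Complex.I * Complex.sin w * Complex.cosh z := by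
  rw [Complex.sinh_sub, mul_comm Complex.I, Complex.cosh_mul_I, Complex.sinh_mul_I]
  ring

theorem nFun_eq (h : α * b ≠ 0) (t ρ : ℝ) :
    nFun α b t ρ = sumCosh α t ρ * pole (b * α) (nullCoord α (t + ρ))
      * pole (b * α) (nullCoord α (t - ρ)) / (1 + ((b * α : ℝ) : ℂ) ^ 2) := by
  have hK := one_add_sq_ne_zero (b * α)
  have hI : (sumCosh α t ρ : ℂ) ≠ 0 := by exact_mod_cast (sumCosh_pos α t ρ).ne'
  rw [nFun, cosh_sub_I_mul, complex_sin_upsilon h, complex_cos_upsilon h, pole_nullCoord_add,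
    pole_nullCoord_sub]
  field_simp
  rw [sumCosh]
  push_cast
  linear_combination Complex.cosh_sq (α * ρ) - Complex.cosh_sq (α * t)
    + (Complex.sinh (α * ρ) ^ 2 - Complex.sinh (α * t) ^ 2) * Complex.I_sq

theorem mFun_eq (h : α * b ≠ 0) (t ρ : ℝ) :
    mFun α b t ρ = sumCosh α t ρ * (pole (b * α) (nullCoord α (t + ρ))
      + pole (b * α) (nullCoord α (t - ρ))) / (1 + ((b * α : ℝ) : ℂ) ^ 2) := by
  have hK := one_add_sq_ne_zero (b * α)
  have hI : (sumCosh α t ρ : ℂ) ≠ 0 := by exact_mod_cast (sumCosh_pos α t ρ).ne'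
  have hsin : Complex.sin (upsilon α b)
      = 2 * Complex.sin (upsilon α b / 2) * Complex.cos (upsilon α b / 2) := by
    rw [← Complex.sin_two_mul, mul_div_cancel₀ _ two_ne_zero]
  have hcos : Complex.cos (upsilon α b) = 2 * Complex.cos (upsilon α b / 2) ^ 2 - 1 := by
    rw [← Complex.cos_two_mul, mul_div_cancel₀ _ two_ne_zero]
  have hexpand : mFun α b t ρ = Complex.sin (upsilon α b) * sumCosh α t ρ
      + Complex.I * (1 + Complex.cos (upsilon α b)) * Complex.sinh (α * t) := by
    rw [mFun, mul_div_assoc, sinh_sub_I_mul, hsin, hcos, sumCosh]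
    push_cast
    linear_combination (-2 * Complex.cos (upsilon α b / 2) * Complex.sin (upsilon α b / 2)
      * Complex.cosh (α * t)) * Complex.I_sq
  rw [hexpand, complex_sin_upsilon h, complex_cos_upsilon h, pole_nullCoord_add,
    pole_nullCoord_sub]
  field_simp
  ring

theorem bracketT_add_bracketR (h : α * b ≠ 0) (t ρ : ℝ) :
    bracketT α b t ρ + bracketR α b t ρ
      = -2 * Complex.I * sumCosh α t ρ * nullDeriv α (t + ρ)
        * pole (b * α) (nullCoord α (t + ρ)) / (α * (1 + ((b * α : ℝ) : ℂ) ^ 2)) := by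
  have hα : (α : ℂ) ≠ 0 := by exact_mod_cast left_ne_zero_of_mul h
  have hK := one_add_sq_ne_zero (b * α)
  have hI : (sumCosh α t ρ : ℂ) ≠ 0 := by exact_mod_cast (sumCosh_pos α t ρ).ne'
  rw [bracketT, bracketR, deriv_coshU_rho, deriv_coshU_t, complex_sin_upsilon h,
    complex_cos_upsilon h, nullDeriv_add, pole_nullCoord_add]
  generalize b * α = q at *
  push_cast
  field_simp
  ring_nf
  rw [Complex.I_sq]
  ring

theorem bracketT_sub_bracketR (h : α * b ≠ 0) (t ρ : ℝ) :
    bracketT α b t ρ - bracketR α b t ρ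
      = 2 * Complex.I * sumCosh α t ρ * nullDeriv α (t - ρ)
        * pole (b * α) (nullCoord α (t - ρ)) / (α * (1 + ((b * α : ℝ) : ℂ) ^ 2)) := by
  have hα : (α : ℂ) ≠ 0 := by exact_mod_cast left_ne_zero_of_mul h
  have hK := one_add_sq_ne_zero (b * α)
  have hI : (sumCosh α t ρ : ℂ) ≠ 0 := by exact_mod_cast (sumCosh_pos α t ρ).ne'
  rw [bracketT, bracketR, deriv_coshU_rho, deriv_coshU_t, complex_sin_upsilon h,
    complex_cos_upsilon h, nullDeriv_sub, pole_nullCoord_sub]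
  generalize b * α = q at *
  push_cast
  field_simp
  ring_nf
  rw [Complex.I_sq]
  ring

theorem bracketX_eq (h : α * b ≠ 0) (t ρ : ℝ) :
    bracketX α b t ρ = sumCosh α t ρ ^ 2 * (pole (b * α) (nullCoord α (t + ρ)) ^ 2
      + pole (b * α) (nullCoord α (t - ρ)) ^ 2) / (2 * (1 + ((b * α : ℝ) : ℂ) ^ 2)) := by
  have hK := one_add_sq_ne_zero (b * α)
  have hI : (sumCosh α t ρ : ℂ) ≠ 0 := by exact_mod_cast (sumCosh_pos α t ρ).ne'
  rw [bracketX, cosh_sub_I_mul, complex_sin_upsilon h, complex_cos_upsilon h, coshU,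
    pole_nullCoord_add, pole_nullCoord_sub]
  generalize b * α = q at *
  push_cast
  field_simp
  ring_nf
  rw [Complex.I_sq, sumCosh]
  push_cast
  rw [Complex.sinh_sq, Complex.sinh_sq]
  ring

theorem bracketY_eq (h : α * b ≠ 0) (t ρ : ℝ) :
    bracketY α b t ρ = sumCosh α t ρ * Complex.sinh (α * ρ)
      * (pole (b * α) (nullCoord α (t + ρ)) + pole (b * α) (nullCoord α (t - ρ)))
      / (1 + ((b * α : ℝ) : ℂ) ^ 2) := by
  have hK := one_add_sq_ne_zero (b * α)
  have hI : (sumCosh α t ρ : ℂ) ≠ 0 := by exact_mod_cast (sumCosh_pos α t ρ).ne'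
  rw [bracketY, sinh_sub_I_mul, complex_sin_upsilon h, complex_cos_upsilon h, pole_nullCoord_add,
    pole_nullCoord_sub]
  generalize b * α = q at *
  field_simp
  ring_nf
  rw [Complex.I_sq, sumCosh]
  push_cast
  ring

end Upsilon

end NullForm

/-- The `dt` component of the potential, up to the factor `e^{iφ} sin θ`. -/
def potT (α b t ρ : ℝ) : ℂ :=
  α ^ 2 * (nullDeriv α (t + ρ) * nullPotential (b * α) (nullCoord α (t + ρ)) (nullCoord α (t - ρ))
    - nullDeriv α (t - ρ) * nullPotential (b * α) (nullCoord α (t - ρ)) (nullCoord α (t + ρ)))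

/-- The `dρ` component of the potential, up to the factor `e^{iφ} sin θ`. -/
def potR (α b t ρ : ℝ) : ℂ :=
  α ^ 2 * (nullDeriv α (t + ρ) * nullPotential (b * α) (nullCoord α (t + ρ)) (nullCoord α (t - ρ))
    + nullDeriv α (t - ρ) * nullPotential (b * α) (nullCoord α (t - ρ)) (nullCoord α (t + ρ)))

/-- The coefficient of `sin θ dφ - i cos θ dθ` in the potential, up to the factor `e^{iφ}`; the
coefficient of `dθ + i sin θ cos θ dφ` is `-χ`. -/
def potAngle (α b t ρ : ℝ) : ℂ :=
  α ^ 2 * anglePotential (b * α) (nullCoord α (t + ρ)) (nullCoord α (t - ρ))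

/-- The components at the angles `(θ, φ)` of the one-form
`e^{iφ} (sin θ (P dt + R dρ) + f (sin θ dφ - i cos θ dθ) - χ (dθ + i sin θ cos θ dφ))`. -/
def modeForm (θ φ : ℝ) (P R f χ : ℂ) : Fin 4 → ℂ :=
  Complex.exp (Complex.I * φ) • ![Complex.sin θ * P, Complex.sin θ * R,
    -Complex.I * Complex.cos θ * f - χ, Complex.sin θ * (f - Complex.I * Complex.cos θ * χ)]

section NullForm

variable {α b : ℝ}

theorem chi_eq (h : α * b ≠ 0) (t ρ : ℝ) : chi α b t ρ
    = α ^ 2 * nullChi (b * α) (nullCoord α (t + ρ)) (nullCoord α (t - ρ)) := by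
  have hq : b * α ≠ 0 := mul_comm α b ▸ h
  have hv := pole_ne_zero hq (nullCoord α (t + ρ))
  have hu := pole_ne_zero hq (nullCoord α (t - ρ))
  have hK := one_add_sq_ne_zero (b * α)
  have hI : (sumCosh α t ρ : ℂ) ≠ 0 := by exact_mod_cast (sumCosh_pos α t ρ).ne'
  have hK' : (1 + (b : ℂ) ^ 2 * α ^ 2) = 1 + ((b * α : ℝ) : ℂ) ^ 2 := by push_cast; ring
  rw [chi, nFun_eq h, complex_sinh_eq α (b * α) t, nullChi, hK']
  field_simp
  simp only [Complex.I_sq]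
  ring

theorem factor1_eq (h : α * b ≠ 0) (x : Fin 4 → ℝ) :
    factor1 α b x = -(α ^ 3 * (1 + ((b * α : ℝ) : ℂ) ^ 2))
        / (sumCosh α (x 0) (x 1) * pole (b * α) (nullCoord α (x 0 + x 1))
          * pole (b * α) (nullCoord α (x 0 - x 1))
          * (pole (b * α) (nullCoord α (x 0 + x 1)) + pole (b * α) (nullCoord α (x 0 - x 1))) ^ 2)
      * (Complex.exp (Complex.I * x 3) * Complex.sin (x 2)) := by
  have hK := one_add_sq_ne_zero (b * α)
  have hI : (sumCosh α (x 0) (x 1) : ℂ) ≠ 0 := by exact_mod_cast (sumCosh_pos α _ _).ne'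
  have hK' : (1 + (α : ℂ) ^ 2 * b ^ 2) = 1 + ((b * α : ℝ) : ℂ) ^ 2 := by push_cast; ring
  rw [factor1, D1, nFun_eq h, mFun_eq h, hK']
  field_simp

theorem factor2_eq (h : α * b ≠ 0) (x : Fin 4 → ℝ) :
    factor2 α b x = -(α ^ 2 * (1 + ((b * α : ℝ) : ℂ) ^ 2) * Complex.sinh (α * x 1))
        / (sumCosh α (x 0) (x 1) ^ 3 * (pole (b * α) (nullCoord α (x 0 + x 1))
          * pole (b * α) (nullCoord α (x 0 - x 1))) ^ 2
          * (pole (b * α) (nullCoord α (x 0 + x 1)) + pole (b * α) (nullCoord α (x 0 - x 1))))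
      * Complex.exp (Complex.I * x 3) := by
  have hK := one_add_sq_ne_zero (b * α)
  have hI : (sumCosh α (x 0) (x 1) : ℂ) ≠ 0 := by exact_mod_cast (sumCosh_pos α _ _).ne'
  have hK' : (1 + (α : ℂ) ^ 2 * b ^ 2) = 1 + ((b * α : ℝ) : ℂ) ^ 2 := by push_cast; ring
  rw [factor2, D2, nFun_eq h, mFun_eq h, hK']
  field_simp

theorem factor1_mul_bracketT_add_bracketR (h : α * b ≠ 0) (x : Fin 4 → ℝ) :
    factor1 α b x * (bracketT α b (x 0) (x 1) + bracketR α b (x 0) (x 1))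
      = 2 * (Complex.exp (Complex.I * x 3) * Complex.sin (x 2)) * (α ^ 2 * nullDeriv α (x 0 + x 1)
        * nullPotential (b * α) (nullCoord α (x 0 + x 1)) (nullCoord α (x 0 - x 1))) := by
  have hq : b * α ≠ 0 := mul_comm α b ▸ h
  have hα : (α : ℂ) ≠ 0 := by exact_mod_cast left_ne_zero_of_mul h
  have hK := one_add_sq_ne_zero (b * α)
  have hI : (sumCosh α (x 0) (x 1) : ℂ) ≠ 0 := by exact_mod_cast (sumCosh_pos α _ _).ne'
  have hv := pole_ne_zero hq (nullCoord α (x 0 + x 1))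
  have hu := pole_ne_zero hq (nullCoord α (x 0 - x 1))
  have hvu := pole_add_pole_ne_zero hq (nullCoord α (x 0 + x 1)) (nullCoord α (x 0 - x 1))
  rw [factor1_eq h, bracketT_add_bracketR h, nullPotential]
  field_simp

theorem factor1_mul_bracketT_sub_bracketR (h : α * b ≠ 0) (x : Fin 4 → ℝ) :
    factor1 α b x * (bracketT α b (x 0) (x 1) - bracketR α b (x 0) (x 1))
      = -2 * (Complex.exp (Complex.I * x 3) * Complex.sin (x 2)) * (α ^ 2 * nullDeriv α (x 0 - x 1)
        * nullPotential (b * α) (nullCoord α (x 0 - x 1)) (nullCoord α (x 0 + x 1))) := by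
  have hq : b * α ≠ 0 := mul_comm α b ▸ h
  have hα : (α : ℂ) ≠ 0 := by exact_mod_cast left_ne_zero_of_mul h
  have hK := one_add_sq_ne_zero (b * α)
  have hI : (sumCosh α (x 0) (x 1) : ℂ) ≠ 0 := by exact_mod_cast (sumCosh_pos α _ _).ne'
  have hv := pole_ne_zero hq (nullCoord α (x 0 + x 1))
  have hu := pole_ne_zero hq (nullCoord α (x 0 - x 1))
  have hvu := pole_add_pole_ne_zero hq (nullCoord α (x 0 + x 1)) (nullCoord α (x 0 - x 1))
  rw [factor1_eq h, bracketT_sub_bracketR h, nullPotential,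
    add_comm (pole (b * α) (nullCoord α (x 0 - x 1)))]
  field_simp

theorem factor2_mul_bracketX (h : α * b ≠ 0) (x : Fin 4 → ℝ) :
    factor2 α b x * bracketX α b (x 0) (x 1)
      = Complex.exp (Complex.I * x 3) * potAngle α b (x 0) (x 1) := by
  have hq : b * α ≠ 0 := mul_comm α b ▸ h
  have hK := one_add_sq_ne_zero (b * α)
  have hI : (sumCosh α (x 0) (x 1) : ℂ) ≠ 0 := by exact_mod_cast (sumCosh_pos α _ _).ne'
  have hv := pole_ne_zero hq (nullCoord α (x 0 + x 1))
  have hu := pole_ne_zero hq (nullCoord α (x 0 - x 1))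
  have hvu := pole_add_pole_ne_zero hq (nullCoord α (x 0 + x 1)) (nullCoord α (x 0 - x 1))
  rw [factor2_eq h, bracketX_eq h, potAngle, anglePotential, complex_sinh_eq α (b * α) (x 0)]
  field_simp
  simp only [Complex.I_sq]
  ring

theorem factor2_mul_bracketY (h : α * b ≠ 0) (x : Fin 4 → ℝ) :
    factor2 α b x * bracketY α b (x 0) (x 1)
      = -(Complex.exp (Complex.I * x 3) * chi α b (x 0) (x 1)) := by
  have hq : b * α ≠ 0 := mul_comm α b ▸ h
  have hK := one_add_sq_ne_zero (b * α)
  have hI : (sumCosh α (x 0) (x 1) : ℂ) ≠ 0 := by exact_mod_cast (sumCosh_pos α _ _).ne'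
  have hv := pole_ne_zero hq (nullCoord α (x 0 + x 1))
  have hu := pole_ne_zero hq (nullCoord α (x 0 - x 1))
  have hvu := pole_add_pole_ne_zero hq (nullCoord α (x 0 + x 1)) (nullCoord α (x 0 - x 1))
  rw [factor2_eq h, bracketY_eq h, chi_eq h, nullChi, complex_sinh_eq α (b * α) (x 0)]
  field_simp
  simp only [Complex.I_sq]
  ring

theorem hopfionA_eq_modeForm (h : α * b ≠ 0) (x : Fin 4 → ℝ) :
    hopfionA α b x = modeForm (x 2) (x 3) (potT α b (x 0) (x 1)) (potR α b (x 0) (x 1))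
      (potAngle α b (x 0) (x 1)) (chi α b (x 0) (x 1)) := by
  have hadd := factor1_mul_bracketT_add_bracketR h x
  have hsub := factor1_mul_bracketT_sub_bracketR h x
  have hX := factor2_mul_bracketX h x
  have hY := factor2_mul_bracketY h x
  funext μ
  fin_cases μ <;>
    simp only [hopfionA, modeForm, Pi.smul_apply, smul_eq_mul, Fin.zero_eta, Fin.mk_one,
      Fin.reduceFinMk, Matrix.cons_val]
  · rw [potT]
    linear_combination (hadd + hsub) / 2
  · rw [potR]
    linear_combination (hadd - hsub) / 2
  · linear_combination -Complex.I * Complex.cos (x 2) * hX + hY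
  · linear_combination Complex.sin (x 2) * hX
      + Complex.I * Complex.sin (x 2) * Complex.cos (x 2) * hY

end NullForm

/-- The derivative of `modeForm` in the angle `θ`. -/
def modeFormTheta (θ φ : ℝ) (P R f χ : ℂ) : Fin 4 → ℂ :=
  Complex.exp (Complex.I * φ) • ![Complex.cos θ * P, Complex.cos θ * R,
    Complex.I * Complex.sin θ * f,
    Complex.cos θ * f - Complex.I * (Complex.cos θ ^ 2 - Complex.sin θ ^ 2) * χ]

/-- The components at the angles `(θ, φ)` of the two-form with the angular dependence of the
hopfion: `E` is the `dt ∧ dρ` component up to `e^{iφ} sin θ`, and `χt`, `χr` stand for the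
derivatives of `χ`. -/
def modeField (θ φ : ℝ) (E χt χr χ : ℂ) : Matrix (Fin 4) (Fin 4) ℂ :=
  let S : ℂ := Complex.sin θ
  let C : ℂ := Complex.cos θ
  Complex.exp (Complex.I * φ) •
    !![0, S * E, -(χt - χr * C), Complex.I * S * (χr - χt * C);
      -(S * E), 0, -(χr - χt * C), Complex.I * S * (χt - χr * C);
      χt - χr * C, χr - χt * C, 0, 2 * Complex.I * S ^ 2 * χ;
      -(Complex.I * S * (χr - χt * C)), -(Complex.I * S * (χt - χr * C)),
        -(2 * Complex.I * S ^ 2 * χ), 0]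

theorem hopfionF_eq_modeField (α b : ℝ) (x : Fin 4 → ℝ) :
    hopfionF α b x = modeField (x 2) (x 3)
      (2 * chi α b (x 0) (x 1) * α ^ 2 / Complex.sinh (α * x 1) ^ 2)
      (chiT α b (x 0) (x 1)) (chiR α b (x 0) (x 1)) (chi α b (x 0) (x 1)) := by
  ext μ ν
  fin_cases μ <;> fin_cases ν <;> simp [hopfionF, modeField, wedge] <;> ring

section ExteriorDerivative

theorem extD_eq_of_hasDerivAt {A : (Fin 4 → ℝ) → Fin 4 → ℂ} {x : Fin 4 → ℝ}
    {D : Fin 4 → Fin 4 → ℂ}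
    (hD : ∀ μ, HasDerivAt (fun s => A (Function.update x μ s)) (D μ) (x μ)) :
    extD A x = fun μ ν => D μ ν - D ν μ := by
  have hpartial (μ ν : Fin 4) : partialDeriv μ (fun y => A y ν) x = D μ ν :=
    (hasDerivAt_pi.1 (hD μ) ν).deriv
  ext μ ν
  rw [extD, hpartial, hpartial]

theorem hasDerivAt_modeForm_profile (θ φ : ℝ) {P R f χ : ℝ → ℂ} {P' R' f' χ' : ℂ} {s : ℝ}
    (hP : HasDerivAt P P' s) (hR : HasDerivAt R R' s) (hf : HasDerivAt f f' s)
    (hχ : HasDerivAt χ χ' s) :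
    HasDerivAt (fun s => modeForm θ φ (P s) (R s) (f s) (χ s)) (modeForm θ φ P' R' f' χ') s := by
  refine hasDerivAt_pi.2 fun μ => ?_
  fin_cases μ
  · exact (hP.const_mul _).const_mul _
  · exact (hR.const_mul _).const_mul _
  · exact ((hf.const_mul _).sub hχ).const_mul _
  · exact ((hf.sub (hχ.const_mul _)).const_mul _).const_mul _

theorem hasDerivAt_modeForm_theta (θ φ : ℝ) (P R f χ : ℂ) :
    HasDerivAt (fun s => modeForm s φ P R f χ) (modeFormTheta θ φ P R f χ) θ := by
  have hsin := (Complex.hasDerivAt_sin (θ : ℂ)).comp_ofReal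
  have hcos := (Complex.hasDerivAt_cos (θ : ℂ)).comp_ofReal
  refine hasDerivAt_pi.2 fun μ => ?_
  fin_cases μ
  · exact (hsin.mul_const P).const_mul _
  · exact (hsin.mul_const R).const_mul _
  · refine ((((hcos.const_mul (-Complex.I)).mul_const f).sub_const χ).const_mul _).congr_deriv ?_
    simp [modeFormTheta]
  · refine ((hsin.mul (((hcos.const_mul Complex.I).mul_const χ).const_sub f)).const_mul
      _).congr_deriv ?_
    simp [modeFormTheta]
    ring

theorem hasDerivAt_modeForm_phi (θ φ : ℝ) (P R f χ : ℂ) :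
    HasDerivAt (fun s => modeForm θ s P R f χ) (Complex.I • modeForm θ φ P R f χ) φ := by
  have hphase : HasDerivAt (fun s : ℝ => Complex.exp (Complex.I * s))
      (Complex.I * Complex.exp (Complex.I * φ)) φ := by
    simpa [mul_comm] using ((hasDerivAt_id (φ : ℂ)).const_mul Complex.I).cexp.comp_ofReal
  exact (hphase.smul_const _).congr_deriv (mul_smul _ _ _)

theorem extD_modeForm {P R f χ : ℝ → ℝ → ℂ} {Pt Pr Rt Rr E χt χr : ℂ} {x : Fin 4 → ℝ}
    (hPt : HasDerivAt (fun s => P s (x 1)) Pt (x 0)) (hPr : HasDerivAt (P (x 0)) Pr (x 1))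
    (hRt : HasDerivAt (fun s => R s (x 1)) Rt (x 0)) (hRr : HasDerivAt (R (x 0)) Rr (x 1))
    (hE : Rt - Pr = E)
    (hft : HasDerivAt (fun s => f s (x 1)) (Complex.I * (P (x 0) (x 1) + χr)) (x 0))
    (hfr : HasDerivAt (f (x 0)) (Complex.I * (R (x 0) (x 1) + χt)) (x 1))
    (hχt : HasDerivAt (fun s => χ s (x 1)) χt (x 0)) (hχr : HasDerivAt (χ (x 0)) χr (x 1)) :
    extD (fun y => modeForm (y 2) (y 3) (P (y 0) (y 1)) (R (y 0) (y 1)) (f (y 0) (y 1))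
      (χ (y 0) (y 1))) x = modeField (x 2) (x 3) E χt χr (χ (x 0) (x 1)) := by
  have hD (μ : Fin 4) : HasDerivAt (fun s => (fun y : Fin 4 → ℝ => modeForm (y 2) (y 3)
      (P (y 0) (y 1)) (R (y 0) (y 1)) (f (y 0) (y 1)) (χ (y 0) (y 1))) (Function.update x μ s))
      (![modeForm (x 2) (x 3) Pt Rt (Complex.I * (P (x 0) (x 1) + χr)) χt,
        modeForm (x 2) (x 3) Pr Rr (Complex.I * (R (x 0) (x 1) + χt)) χr,
        modeFormTheta (x 2) (x 3) (P (x 0) (x 1)) (R (x 0) (x 1)) (f (x 0) (x 1)) (χ (x 0) (x 1)),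
        Complex.I • modeForm (x 2) (x 3) (P (x 0) (x 1)) (R (x 0) (x 1)) (f (x 0) (x 1))
          (χ (x 0) (x 1))] μ) (x μ) := by
    fin_cases μ
    · exact hasDerivAt_modeForm_profile (x 2) (x 3) hPt hRt hft hχt
    · exact hasDerivAt_modeForm_profile (x 2) (x 3) hPr hRr hfr hχr
    · exact hasDerivAt_modeForm_theta (x 2) (x 3) (P (x 0) (x 1)) (R (x 0) (x 1)) (f (x 0) (x 1))
        (χ (x 0) (x 1))
    · exact hasDerivAt_modeForm_phi (x 2) (x 3) (P (x 0) (x 1)) (R (x 0) (x 1)) (f (x 0) (x 1))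
        (χ (x 0) (x 1))
  rw [extD_eq_of_hasDerivAt hD, ← hE]
  ext μ ν
  fin_cases μ <;> fin_cases ν <;>
    simp only [modeForm, modeFormTheta, modeField, Pi.smul_apply, Matrix.smul_apply, smul_eq_mul,
      Fin.zero_eta, Fin.mk_one, Fin.reduceFinMk, Matrix.of_apply, Matrix.cons_val] <;>
    ring_nf <;> simp only [Complex.I_sq, Complex.cos_sq'] <;> ring

end ExteriorDerivative

section HopfionDerivatives

variable {α b : ℝ}

theorem hasDerivAt_chi_t (h : α * b ≠ 0) (t ρ : ℝ) : HasDerivAt (fun s => chi α b s ρ)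
    (α ^ 2 * (nullDeriv α (t + ρ)
        * nullChiDeriv (b * α) (nullCoord α (t + ρ)) (nullCoord α (t - ρ))
      + nullDeriv α (t - ρ)
        * nullChiDeriv (b * α) (nullCoord α (t - ρ)) (nullCoord α (t + ρ)))) t := by
  have hq : b * α ≠ 0 := mul_comm α b ▸ h
  simp only [chi_eq h]
  refine ((hasDerivAt_nullChi hq ((hasDerivAt_nullCoord α (t + ρ)).comp_add_const t ρ)
    ((hasDerivAt_nullCoord α (t - ρ)).comp_sub_const t ρ)).const_mul _).congr_deriv ?_
  ring

theorem hasDerivAt_chi_rho (h : α * b ≠ 0) (t ρ : ℝ) : HasDerivAt (fun r => chi α b t r)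
    (α ^ 2 * (nullDeriv α (t + ρ)
        * nullChiDeriv (b * α) (nullCoord α (t + ρ)) (nullCoord α (t - ρ))
      - nullDeriv α (t - ρ)
        * nullChiDeriv (b * α) (nullCoord α (t - ρ)) (nullCoord α (t + ρ)))) ρ := by
  have hq : b * α ≠ 0 := mul_comm α b ▸ h
  simp only [chi_eq h]
  refine ((hasDerivAt_nullChi hq ((hasDerivAt_nullCoord α (t + ρ)).comp_const_add t ρ)
    ((hasDerivAt_nullCoord α (t - ρ)).comp_const_sub t ρ)).const_mul _).congr_deriv ?_
  push_cast
  ring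

theorem chiT_eq (h : α * b ≠ 0) (t ρ : ℝ) : chiT α b t ρ
    = α ^ 2 * (nullDeriv α (t + ρ)
        * nullChiDeriv (b * α) (nullCoord α (t + ρ)) (nullCoord α (t - ρ))
      + nullDeriv α (t - ρ)
        * nullChiDeriv (b * α) (nullCoord α (t - ρ)) (nullCoord α (t + ρ))) :=
  (hasDerivAt_chi_t h t ρ).deriv

theorem chiR_eq (h : α * b ≠ 0) (t ρ : ℝ) : chiR α b t ρ
    = α ^ 2 * (nullDeriv α (t + ρ)
        * nullChiDeriv (b * α) (nullCoord α (t + ρ)) (nullCoord α (t - ρ))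
      - nullDeriv α (t - ρ)
        * nullChiDeriv (b * α) (nullCoord α (t - ρ)) (nullCoord α (t + ρ))) :=
  (hasDerivAt_chi_rho h t ρ).deriv

theorem hasDerivAt_potAngle_t (h : α * b ≠ 0) (t ρ : ℝ) :
    HasDerivAt (fun s => potAngle α b s ρ)
      (Complex.I * (potT α b t ρ + chiR α b t ρ)) t := by
  have hq : b * α ≠ 0 := mul_comm α b ▸ h
  refine ((hasDerivAt_anglePotential hq ((hasDerivAt_nullCoord α (t + ρ)).comp_add_const t ρ)
    ((hasDerivAt_nullCoord α (t - ρ)).comp_sub_const t ρ)).const_mul _).congr_deriv ?_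
  rw [chiR_eq h, potT]
  ring

theorem hasDerivAt_potAngle_rho (h : α * b ≠ 0) (t ρ : ℝ) :
    HasDerivAt (fun r => potAngle α b t r)
      (Complex.I * (potR α b t ρ + chiT α b t ρ)) ρ := by
  have hq : b * α ≠ 0 := mul_comm α b ▸ h
  refine ((hasDerivAt_anglePotential hq ((hasDerivAt_nullCoord α (t + ρ)).comp_const_add t ρ)
    ((hasDerivAt_nullCoord α (t - ρ)).comp_const_sub t ρ)).const_mul _).congr_deriv ?_
  rw [chiT_eq h, potR]
  push_cast
  ring

theorem nullPotential_curl {q : ℝ} (hq : q ≠ 0) (v u : ℝ) :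
    2 / (pole q u * (pole q v + pole q u) ^ 3) + 1 / (pole q u ^ 2 * (pole q v + pole q u) ^ 2)
        + (2 / (pole q v * (pole q u + pole q v) ^ 3)
          + 1 / (pole q v ^ 2 * (pole q u + pole q v) ^ 2))
      = 1 / (pole q v * pole q u) ^ 2 := by
  have hv := pole_ne_zero hq v
  have hu := pole_ne_zero hq u
  have hvu := pole_add_pole_ne_zero hq v u
  rw [add_comm (pole q u) (pole q v)]
  field_simp
  ring

theorem deriv_potR_sub_deriv_potT (h : α * b ≠ 0) (t ρ : ℝ) :
    deriv (fun s => potR α b s ρ) t - deriv (fun r => potT α b t r) ρ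
      = 2 * α ^ 2 * (nullDeriv α (t + ρ) * nullDeriv α (t - ρ))
        / (pole (b * α) (nullCoord α (t + ρ)) * pole (b * α) (nullCoord α (t - ρ))) ^ 2 := by
  have hq : b * α ≠ 0 := mul_comm α b ▸ h
  have hvt := (hasDerivAt_nullCoord α (t + ρ)).comp_add_const t ρ
  have hut := (hasDerivAt_nullCoord α (t - ρ)).comp_sub_const t ρ
  have hvr := (hasDerivAt_nullCoord α (t + ρ)).comp_const_add t ρ
  have hur := (hasDerivAt_nullCoord α (t - ρ)).comp_const_sub t ρ
  have hkvt := ((hasDerivAt_nullDeriv α (t + ρ)).comp_add_const t ρ).ofReal_comp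
  have hkut := ((hasDerivAt_nullDeriv α (t - ρ)).comp_sub_const t ρ).ofReal_comp
  have hkvr := ((hasDerivAt_nullDeriv α (t + ρ)).comp_const_add t ρ).ofReal_comp
  have hkur := ((hasDerivAt_nullDeriv α (t - ρ)).comp_const_sub t ρ).ofReal_comp
  have hR := ((hkvt.mul (hasDerivAt_nullPotential hq hvt hut)).add
    (hkut.mul (hasDerivAt_nullPotential hq hut hvt))).const_mul ((α : ℂ) ^ 2)
  have hT := ((hkvr.mul (hasDerivAt_nullPotential hq hvr hur)).sub
    (hkur.mul (hasDerivAt_nullPotential hq hur hvr))).const_mul ((α : ℂ) ^ 2)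
  have hcurl := nullPotential_curl hq (nullCoord α (t + ρ)) (nullCoord α (t - ρ))
  refine (congrArg₂ (· - ·) hR.deriv hT.deriv).trans ?_
  push_cast
  linear_combination 2 * (α : ℂ) ^ 2 * (nullDeriv α (t + ρ) * nullDeriv α (t - ρ)) * hcurl

theorem deriv_potR_sub_deriv_potT_eq_chi (h : α * b ≠ 0) (t : ℝ) {ρ : ℝ} (hρ : ρ ≠ 0) :
    deriv (fun s => potR α b s ρ) t - deriv (fun r => potT α b t r) ρ
      = 2 * chi α b t ρ * α ^ 2 / Complex.sinh (α * ρ) ^ 2 := by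
  have hq : b * α ≠ 0 := mul_comm α b ▸ h
  have hα : α ≠ 0 := left_ne_zero_of_mul h
  have hsinh : Complex.sinh (α * ρ) ≠ 0 := by
    exact_mod_cast sinh_ne_zero.2 (mul_ne_zero hα hρ)
  have hkk : (nullDeriv α (t + ρ) * nullDeriv α (t - ρ) * Complex.sinh (α * ρ) ^ 2 : ℂ)
      = α ^ 2 * (((nullCoord α (t + ρ) - nullCoord α (t - ρ)) / 2 : ℝ) : ℂ) ^ 2 := by
    exact_mod_cast nullDeriv_mul_nullDeriv α t ρ
  have hv := pole_ne_zero hq (nullCoord α (t + ρ))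
  have hu := pole_ne_zero hq (nullCoord α (t - ρ))
  rw [deriv_potR_sub_deriv_potT h, chi_eq h, nullChi_eq_div hq]
  field_simp
  linear_combination (α : ℂ) ^ 2 * hkk

section Smoothness

variable {E : Type*} [NormedAddCommGroup E] [NormedSpace ℝ E] {t ρ : E → ℝ} {n : WithTop ℕ∞}

theorem contDiff_potT (h : α * b ≠ 0) (ht : ContDiff ℝ n t) (hρ : ContDiff ℝ n ρ) :
    ContDiff ℝ n fun x => potT α b (t x) (ρ x) := by
  have hq : b * α ≠ 0 := mul_comm α b ▸ h
  have hv := (contDiff_nullCoord α).comp (ht.add hρ)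
  have hu := (contDiff_nullCoord α).comp (ht.sub hρ)
  have hkv := Complex.ofRealCLM.contDiff.comp ((contDiff_nullDeriv α).comp (ht.add hρ))
  have hku := Complex.ofRealCLM.contDiff.comp ((contDiff_nullDeriv α).comp (ht.sub hρ))
  exact contDiff_const.mul ((hkv.mul (contDiff_nullPotential hq hv hu)).sub
    (hku.mul (contDiff_nullPotential hq hu hv)))

theorem contDiff_potR (h : α * b ≠ 0) (ht : ContDiff ℝ n t) (hρ : ContDiff ℝ n ρ) :
    ContDiff ℝ n fun x => potR α b (t x) (ρ x) := by
  have hq : b * α ≠ 0 := mul_comm α b ▸ h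
  have hv := (contDiff_nullCoord α).comp (ht.add hρ)
  have hu := (contDiff_nullCoord α).comp (ht.sub hρ)
  have hkv := Complex.ofRealCLM.contDiff.comp ((contDiff_nullDeriv α).comp (ht.add hρ))
  have hku := Complex.ofRealCLM.contDiff.comp ((contDiff_nullDeriv α).comp (ht.sub hρ))
  exact contDiff_const.mul ((hkv.mul (contDiff_nullPotential hq hv hu)).add
    (hku.mul (contDiff_nullPotential hq hu hv)))

theorem contDiff_potAngle (h : α * b ≠ 0) (ht : ContDiff ℝ n t) (hρ : ContDiff ℝ n ρ) :
    ContDiff ℝ n fun x => potAngle α b (t x) (ρ x) :=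
  contDiff_const.mul (contDiff_anglePotential (mul_comm α b ▸ h)
    ((contDiff_nullCoord α).comp (ht.add hρ)) ((contDiff_nullCoord α).comp (ht.sub hρ)))

theorem contDiff_chi (h : α * b ≠ 0) (ht : ContDiff ℝ n t) (hρ : ContDiff ℝ n ρ) :
    ContDiff ℝ n fun x => chi α b (t x) (ρ x) := by
  simp only [chi_eq h]
  exact contDiff_const.mul (contDiff_nullChi (mul_comm α b ▸ h)
    ((contDiff_nullCoord α).comp (ht.add hρ)) ((contDiff_nullCoord α).comp (ht.sub hρ)))

theorem contDiff_hopfionA (h : α * b ≠ 0) : ContDiff ℝ n (hopfionA α b) := by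
  have hcoord (μ : Fin 4) : ContDiff ℝ n fun x : Fin 4 → ℝ => x μ := contDiff_apply ℝ ℝ μ
  have hcoordC (μ : Fin 4) : ContDiff ℝ n fun x : Fin 4 → ℝ => (x μ : ℂ) :=
    Complex.ofRealCLM.contDiff.comp (hcoord μ)
  have hsin : ContDiff ℝ n fun x : Fin 4 → ℝ => Complex.sin (x 2) :=
    (Complex.contDiff_sin.restrict_scalars ℝ).comp (hcoordC 2)
  have hcos : ContDiff ℝ n fun x : Fin 4 → ℝ => Complex.cos (x 2) :=
    (Complex.contDiff_cos.restrict_scalars ℝ).comp (hcoordC 2)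
  have hT := contDiff_potT h (hcoord 0) (hcoord 1)
  have hR := contDiff_potR h (hcoord 0) (hcoord 1)
  have hf := contDiff_potAngle h (hcoord 0) (hcoord 1)
  have hχ := contDiff_chi h (hcoord 0) (hcoord 1)
  rw [funext (hopfionA_eq_modeForm h)]
  refine contDiff_pi.2 fun μ => ?_
  fin_cases μ <;> simp only [modeForm, Pi.smul_apply, smul_eq_mul, Fin.zero_eta, Fin.mk_one,
    Fin.reduceFinMk, Matrix.cons_val] <;> fun_prop

end Smoothness

theorem extD_hopfionA (h : α * b ≠ 0) {x : Fin 4 → ℝ} (hx : x 1 ≠ 0) :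
    extD (hopfionA α b) x = hopfionF α b x := by
  have hT_t : ContDiff ℝ 1 fun s => potT α b s (x 1) := contDiff_potT h contDiff_id contDiff_const
  have hT_rho : ContDiff ℝ 1 (potT α b (x 0)) := contDiff_potT h contDiff_const contDiff_id
  have hR_t : ContDiff ℝ 1 fun s => potR α b s (x 1) := contDiff_potR h contDiff_id contDiff_const
  have hR_rho : ContDiff ℝ 1 (potR α b (x 0)) := contDiff_potR h contDiff_const contDiff_id
  rw [hopfionF_eq_modeField, funext (hopfionA_eq_modeForm h)]
  exact extD_modeForm (hT_t.differentiable_one _).hasDerivAt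
    (hT_rho.differentiable_one _).hasDerivAt
    (hR_t.differentiable_one _).hasDerivAt (hR_rho.differentiable_one _).hasDerivAt
    (deriv_potR_sub_deriv_potT_eq_chi h (x 0) hx)
    (hasDerivAt_potAngle_t h (x 0) (x 1)) (hasDerivAt_potAngle_rho h (x 0) (x 1))
    (hasDerivAt_chi_t h (x 0) (x 1)).differentiableAt.hasDerivAt
    (hasDerivAt_chi_rho h (x 0) (x 1)).differentiableAt.hasDerivAt

end HopfionDerivatives

/-- The diagonal of the inverse metric. -/
def invMetric (α ρ θ : ℝ) : Fin 4 → ℝ :=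
  ![-cosh (α * ρ) ^ 2, cosh (α * ρ) ^ 2, α ^ 2 / tanh (α * ρ) ^ 2,
    α ^ 2 / (tanh (α * ρ) ^ 2 * sin θ ^ 2)]

section Metric

variable {α : ℝ} {x : Fin 4 → ℝ}

theorem tanh_ne_zero {y : ℝ} (hy : y ≠ 0) : tanh y ≠ 0 := by
  rw [tanh_eq_sinh_div_cosh]
  exact div_ne_zero (sinh_ne_zero.2 hy) (cosh_pos y).ne'

theorem metric_inv (hα : α ≠ 0) (hρ : x 1 ≠ 0) (hθ : sin (x 2) ≠ 0) :
    (metric α x)⁻¹ = Matrix.diagonal (invMetric α (x 1) (x 2)) := by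
  have hcosh := (cosh_pos (α * x 1)).ne'
  have htanh := tanh_ne_zero (mul_ne_zero hα hρ)
  apply Matrix.inv_eq_right_inv
  rw [metric, Matrix.diagonal_mul_diagonal, ← Matrix.diagonal_one]
  congr 1
  funext μ
  fin_cases μ <;> simp [invMetric] <;> field_simp

theorem raise_eq (hα : α ≠ 0) (hρ : x 1 ≠ 0) (hθ : sin (x 2) ≠ 0)
    (W : Matrix (Fin 4) (Fin 4) ℂ) (μ ν : Fin 4) :
    raise α x W μ ν
      = ((invMetric α (x 1) (x 2) μ * invMetric α (x 1) (x 2) ν : ℝ) : ℂ) * W μ ν := by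
  rw [raise, metric_inv hα hρ hθ]
  simp [Matrix.diagonal_apply, apply_ite Complex.ofReal]

theorem volumeFactor_eq (α : ℝ) (hθ : 0 ≤ sin (x 2)) : volumeFactor α x
    = tanh (α * x 1) ^ 2 / (α ^ 2 * cosh (α * x 1) ^ 2) * sin (x 2) := by
  have hdet : (metric α x).det
      = -(tanh (α * x 1) ^ 2 / (α ^ 2 * cosh (α * x 1) ^ 2) * sin (x 2)) ^ 2 := by
    rw [metric, Matrix.det_diagonal, Fin.prod_univ_four]
    simp only [Matrix.cons_val]
    ring
  rw [volumeFactor, hdet, abs_neg, abs_sq, sqrt_sq]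
  positivity

theorem helicityCurrent_of_sin_eq_zero (α : ℝ) (F : (Fin 4 → ℝ) → Matrix (Fin 4) (Fin 4) ℂ)
    (A : (Fin 4 → ℝ) → Fin 4 → ℂ) (hθ : sin (x 2) = 0) (μ : Fin 4) :
    helicityCurrent α F A x μ = 0 := by
  simp [helicityCurrent, volumeFactor_eq α hθ.ge, hθ]

theorem helicityCurrent_eq_sum (hα : α ≠ 0) (hρ : x 1 ≠ 0) (hθ : 0 < sin (x 2))
    (F : (Fin 4 → ℝ) → Matrix (Fin 4) (Fin 4) ℂ) (A : (Fin 4 → ℝ) → Fin 4 → ℂ) (μ : Fin 4) :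
    helicityCurrent α F A x μ
      = 1 / (8 * π) * ∑ ν, tanh (α * x 1) ^ 2 / (α ^ 2 * cosh (α * x 1) ^ 2) * sin (x 2)
        * (invMetric α (x 1) (x 2) μ * invMetric α (x 1) (x 2) ν)
        * (F x μ ν * (starRingEnd ℂ) (A x ν)).im := by
  rw [helicityCurrent, volumeFactor_eq α hθ.le, mul_assoc, Finset.mul_sum]
  congr 1
  refine Finset.sum_congr rfl fun ν _ => ?_
  rw [raise_eq hα hρ hθ.ne', Complex.im_ofReal_mul, Complex.re_ofReal_mul, Complex.mul_im,
    Complex.conj_re, Complex.conj_im]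
  ring

end Metric

section ModeCurrent

variable {α : ℝ} {x : Fin 4 → ℝ} {F : (Fin 4 → ℝ) → Matrix (Fin 4) (Fin 4) ℂ}
  {A : (Fin 4 → ℝ) → Fin 4 → ℂ} {χt χr χ P R f : ℂ}

theorem im_phase_mul_conj (φ : ℝ) (z w : ℂ) :
    (Complex.exp (Complex.I * φ) * z
      * (starRingEnd ℂ) (Complex.exp (Complex.I * φ) * w)).im = (z * (starRingEnd ℂ) w).im := by
  have hphase :
      Complex.exp (Complex.I * φ) * (starRingEnd ℂ) (Complex.exp (Complex.I * φ)) = 1 := by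
    rw [Complex.mul_conj, Complex.normSq_eq_norm_sq, mul_comm, Complex.norm_exp_ofReal_mul_I]
    simp
  congr 1
  rw [map_mul]
  linear_combination z * (starRingEnd ℂ) w * hphase

theorem helicityCurrent_mode_t (hα : α ≠ 0) (hρ : x 1 ≠ 0) (hθ : 0 < sin (x 2))
    (hF : F x = modeField (x 2) (x 3) (2 * χ * α ^ 2 / Complex.sinh (α * x 1) ^ 2) χt χr χ)
    (hA : A x = modeForm (x 2) (x 3) P R f χ) :
    helicityCurrent α F A x 0 = -(1 / (8 * π)) * (sin (x 2) *
      (2 * sin (x 2) ^ 2 * (χ * (starRingEnd ℂ) R).im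
        + (1 + cos (x 2) ^ 2)
          * (χt * (starRingEnd ℂ) χ + Complex.I * χr * (starRingEnd ℂ) f).im
        - 2 * cos (x 2)
          * (χr * (starRingEnd ℂ) χ + Complex.I * χt * (starRingEnd ℂ) f).im)) := by
  have hs := hθ.ne'
  have hsinh : sinh (α * x 1) ≠ 0 := sinh_ne_zero.2 (mul_ne_zero hα hρ)
  have hcosh := (cosh_pos (α * x 1)).ne'
  have hE : 2 * χ * α ^ 2 / Complex.sinh (α * x 1) ^ 2
      = ((2 * α ^ 2 / sinh (α * x 1) ^ 2 : ℝ) : ℂ) * χ := by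
    push_cast
    ring
  rw [helicityCurrent_eq_sum hα hρ hθ, hF, hA, hE, Fin.sum_univ_four]
  simp only [modeField, modeForm, Pi.smul_apply, Matrix.smul_apply, smul_eq_mul, Matrix.of_apply,
    Matrix.cons_val, im_phase_mul_conj, ← Complex.ofReal_sin, ← Complex.ofReal_cos,
    ← Complex.ofReal_pow]
  simp only [Complex.mul_im, Complex.mul_re, Complex.add_im, Complex.sub_im,
    Complex.sub_re, Complex.neg_im, Complex.neg_re, Complex.I_im, Complex.I_re, Complex.ofReal_im,
    Complex.ofReal_re, Complex.conj_im, Complex.conj_re, Complex.zero_im, Complex.zero_re,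
    invMetric, Matrix.cons_val, tanh_eq_sinh_div_cosh]
  field_simp
  ring

theorem helicityCurrent_mode_rho (hα : α ≠ 0) (hρ : x 1 ≠ 0) (hθ : 0 < sin (x 2))
    (hF : F x = modeField (x 2) (x 3) (2 * χ * α ^ 2 / Complex.sinh (α * x 1) ^ 2) χt χr χ)
    (hA : A x = modeForm (x 2) (x 3) P R f χ) :
    helicityCurrent α F A x 1 = 1 / (8 * π) * (sin (x 2) *
      (2 * sin (x 2) ^ 2 * (χ * (starRingEnd ℂ) P).im
        + (1 + cos (x 2) ^ 2)
          * (χr * (starRingEnd ℂ) χ + Complex.I * χt * (starRingEnd ℂ) f).im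
        - 2 * cos (x 2)
          * (χt * (starRingEnd ℂ) χ + Complex.I * χr * (starRingEnd ℂ) f).im)) := by
  have hs := hθ.ne'
  have hsinh : sinh (α * x 1) ≠ 0 := sinh_ne_zero.2 (mul_ne_zero hα hρ)
  have hcosh := (cosh_pos (α * x 1)).ne'
  have hE : 2 * χ * α ^ 2 / Complex.sinh (α * x 1) ^ 2
      = ((2 * α ^ 2 / sinh (α * x 1) ^ 2 : ℝ) : ℂ) * χ := by
    push_cast
    ring
  rw [helicityCurrent_eq_sum hα hρ hθ, hF, hA, hE, Fin.sum_univ_four]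
  simp only [modeField, modeForm, Pi.smul_apply, Matrix.smul_apply, smul_eq_mul, Matrix.of_apply,
    Matrix.cons_val, im_phase_mul_conj, ← Complex.ofReal_sin, ← Complex.ofReal_cos,
    ← Complex.ofReal_pow]
  simp only [Complex.mul_im, Complex.mul_re, Complex.add_im, Complex.sub_im,
    Complex.sub_re, Complex.neg_im, Complex.neg_re, Complex.I_im, Complex.I_re, Complex.ofReal_im,
    Complex.ofReal_re, Complex.conj_im, Complex.conj_re, Complex.zero_im, Complex.zero_re,
    invMetric, Matrix.cons_val, tanh_eq_sinh_div_cosh]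
  field_simp
  ring

end ModeCurrent

/-- The part of the null helicity current carried by the `dt` and `dρ` components of the
potential. -/
def radialDensity (q v u : ℝ) : ℝ :=
  (nullChi q v u * (starRingEnd ℂ) (nullPotential q v u)).im

/-- The part of the null helicity current carried by the `dθ` and `dφ` components of the
potential. -/
def angularDensity (q v u : ℝ) : ℝ :=
  (nullChiDeriv q v u
    * ((starRingEnd ℂ) (nullChi q v u) + Complex.I * (starRingEnd ℂ) (anglePotential q v u))).im

/-- The helicity current along the null direction of `v`, at polar angle `θ`, up to the factor
`α⁴ / 8π`; the current along the other null direction is obtained by swapping `v` and `u` and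
replacing `θ` by `π - θ`. -/
def nullCurrent (q v u θ : ℝ) : ℝ :=
  sin θ * (2 * sin θ ^ 2 * radialDensity q v u + (1 - cos θ) ^ 2 * angularDensity q v u)

/-- The average of `nullCurrent` over the sphere, up to the factor `4 / 3`. -/
def sphereDensity (q v u : ℝ) : ℝ := radialDensity q v u + angularDensity q v u

section NullCurrent

variable {α b q : ℝ}

theorem hopfionCurrent_zero_eq (h : α * b ≠ 0) (t : ℝ) {ρ θ : ℝ} (hρ : ρ ≠ 0) (hθ : 0 ≤ sin θ)
    (φ : ℝ) : hopfionCurrent α b t ρ θ φ 0 = -(α ^ 4 / (8 * π))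
      * (nullDeriv α (t + ρ) * nullCurrent (b * α) (nullCoord α (t + ρ)) (nullCoord α (t - ρ)) θ
        + nullDeriv α (t - ρ)
          * nullCurrent (b * α) (nullCoord α (t - ρ)) (nullCoord α (t + ρ)) (π - θ)) := by
  rcases hθ.eq_or_lt with hsin | hsin
  · rw [hopfionCurrent, helicityCurrent_of_sin_eq_zero α _ _ (by simpa using hsin.symm)]
    simp [nullCurrent, ← hsin]
  rw [hopfionCurrent, helicityCurrent_mode_t (left_ne_zero_of_mul h) (by simpa using hρ)
    (by simpa using hsin) (hopfionF_eq_modeField α b _) (hopfionA_eq_modeForm h _)]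
  simp only [Matrix.cons_val, chi_eq h, chiT_eq h, chiR_eq h, potR, potAngle, nullCurrent,
    radialDensity, angularDensity, sin_pi_sub, cos_pi_sub]
  rw [nullChi_comm _ (nullCoord α (t + ρ)), anglePotential_comm _ (nullCoord α (t + ρ))]
  simp only [← Complex.ofReal_pow, map_mul, map_add, map_neg, Complex.conj_ofReal, Complex.mul_im,
    Complex.mul_re, Complex.add_im, Complex.add_re, Complex.sub_im, Complex.sub_re, Complex.neg_im,
    Complex.neg_re, Complex.I_im, Complex.I_re, Complex.ofReal_im, Complex.ofReal_re,
    Complex.conj_im, Complex.conj_re]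
  ring

theorem hopfionCurrent_one_eq (h : α * b ≠ 0) (t : ℝ) {ρ θ : ℝ} (hρ : ρ ≠ 0) (hθ : 0 ≤ sin θ)
    (φ : ℝ) : hopfionCurrent α b t ρ θ φ 1 = α ^ 4 / (8 * π)
      * (nullDeriv α (t + ρ) * nullCurrent (b * α) (nullCoord α (t + ρ)) (nullCoord α (t - ρ)) θ
        - nullDeriv α (t - ρ)
          * nullCurrent (b * α) (nullCoord α (t - ρ)) (nullCoord α (t + ρ)) (π - θ)) := by
  rcases hθ.eq_or_lt with hsin | hsin
  · rw [hopfionCurrent, helicityCurrent_of_sin_eq_zero α _ _ (by simpa using hsin.symm)]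
    simp [nullCurrent, ← hsin]
  rw [hopfionCurrent, helicityCurrent_mode_rho (left_ne_zero_of_mul h) (by simpa using hρ)
    (by simpa using hsin) (hopfionF_eq_modeField α b _) (hopfionA_eq_modeForm h _)]
  simp only [Matrix.cons_val, chi_eq h, chiT_eq h, chiR_eq h, potT, potAngle, nullCurrent,
    radialDensity, angularDensity, sin_pi_sub, cos_pi_sub]
  rw [nullChi_comm _ (nullCoord α (t + ρ)), anglePotential_comm _ (nullCoord α (t + ρ))]
  simp only [← Complex.ofReal_pow, map_mul, map_sub, map_neg, Complex.conj_ofReal, Complex.mul_im,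
    Complex.mul_re, Complex.add_im, Complex.add_re, Complex.sub_im, Complex.sub_re, Complex.neg_im,
    Complex.neg_re, Complex.I_im, Complex.I_re, Complex.ofReal_im, Complex.ofReal_re,
    Complex.conj_im, Complex.conj_re]
  ring

theorem integral_nullCurrent (q v u : ℝ) :
    ∫ θ in (0 : ℝ)..π, nullCurrent q v u θ = 8 / 3 * sphereDensity q v u := by
  have hderiv (θ : ℝ) : HasDerivAt
      (fun θ => 2 * (cos θ ^ 3 / 3 - cos θ) * radialDensity q v u
        + (1 - cos θ) ^ 3 / 3 * angularDensity q v u) (nullCurrent q v u θ) θ := by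
    have hcos := hasDerivAt_cos θ
    refine ((((((hcos.pow 3).div_const 3).sub hcos).const_mul 2).mul_const _).add
      ((((hcos.const_sub 1).pow 3).div_const 3).mul_const _)).congr_deriv ?_
    rw [nullCurrent, sin_sq]
    norm_num
    ring
  rw [intervalIntegral.integral_eq_sub_of_hasDerivAt (fun θ _ => hderiv θ)
    (Continuous.intervalIntegrable (by unfold nullCurrent; fun_prop) _ _), sphereDensity]
  simp only [cos_pi, cos_zero]
  ring

theorem integral_nullCurrent_reflect (q v u : ℝ) :
    ∫ θ in (0 : ℝ)..π, nullCurrent q v u (π - θ) = 8 / 3 * sphereDensity q v u := by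
  rw [intervalIntegral.integral_comp_sub_left, sub_self, sub_zero, integral_nullCurrent]

theorem integral_sphere_nullCurrent (c k l v u : ℝ) :
    ∫ θ in (0 : ℝ)..π, ∫ _φ in (0 : ℝ)..(2 * π),
        c / (8 * π) * (k * nullCurrent q v u θ + l * nullCurrent q u v (π - θ))
      = 2 / 3 * c * (k * sphereDensity q v u + l * sphereDensity q u v) := by
  simp only [intervalIntegral.integral_const, smul_eq_mul, intervalIntegral.integral_const_mul]
  rw [intervalIntegral.integral_add
    (Continuous.intervalIntegrable (by unfold nullCurrent; fun_prop) _ _)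
    (Continuous.intervalIntegrable (by unfold nullCurrent; fun_prop) _ _)]
  simp only [intervalIntegral.integral_const_mul, integral_nullCurrent,
    integral_nullCurrent_reflect]
  field_simp
  ring

theorem integral_sphere_hopfionCurrent_zero (h : α * b ≠ 0) (t : ℝ) {ρ : ℝ} (hρ : ρ ≠ 0) :
    ∫ θ in (0 : ℝ)..π, ∫ φ in (0 : ℝ)..(2 * π), hopfionCurrent α b t ρ θ φ 0
      = -(2 / 3) * α ^ 4
        * (nullDeriv α (t + ρ) * sphereDensity (b * α) (nullCoord α (t + ρ)) (nullCoord α (t - ρ))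
          + nullDeriv α (t - ρ)
            * sphereDensity (b * α) (nullCoord α (t - ρ)) (nullCoord α (t + ρ))) := by
  rw [intervalIntegral.integral_congr fun θ hθ => intervalIntegral.integral_congr fun φ _ =>
    hopfionCurrent_zero_eq h t hρ (sin_nonneg_of_mem_Icc (uIcc_of_le pi_pos.le ▸ hθ)) φ]
  simp only [← neg_div, integral_sphere_nullCurrent]
  ring

theorem integral_sphere_hopfionCurrent_one (h : α * b ≠ 0) (t : ℝ) {ρ : ℝ} (hρ : ρ ≠ 0) :
    ∫ θ in (0 : ℝ)..π, ∫ φ in (0 : ℝ)..(2 * π), hopfionCurrent α b t ρ θ φ 1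
      = 2 / 3 * α ^ 4
        * (nullDeriv α (t + ρ) * sphereDensity (b * α) (nullCoord α (t + ρ)) (nullCoord α (t - ρ))
          - nullDeriv α (t - ρ)
            * sphereDensity (b * α) (nullCoord α (t - ρ)) (nullCoord α (t + ρ))) := by
  rw [intervalIntegral.integral_congr fun θ hθ => intervalIntegral.integral_congr fun φ _ =>
    hopfionCurrent_one_eq h t hρ (sin_nonneg_of_mem_Icc (uIcc_of_le pi_pos.le ▸ hθ)) φ]
  simpa only [neg_mul, ← sub_eq_add_neg] using integral_sphere_nullCurrent (q := b * α) (α ^ 4)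
    (nullDeriv α (t + ρ)) (-nullDeriv α (t - ρ)) (nullCoord α (t + ρ)) (nullCoord α (t - ρ))

end NullCurrent

section Integrability

variable {α b q : ℝ}

theorem continuous_radialDensity (hq : q ≠ 0) :
    Continuous fun p : ℝ × ℝ => radialDensity q p.1 p.2 :=
  Complex.continuous_im.comp
    ((contDiff_nullChi (n := 0) hq contDiff_fst contDiff_snd).continuous.mul
      (Complex.continuous_conj.comp
        (contDiff_nullPotential (n := 0) hq contDiff_fst contDiff_snd).continuous))

theorem continuous_angularDensity (hq : q ≠ 0) :
    Continuous fun p : ℝ × ℝ => angularDensity q p.1 p.2 :=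
  Complex.continuous_im.comp
    ((contDiff_nullChiDeriv (n := 0) hq contDiff_fst contDiff_snd).continuous.mul
      ((Complex.continuous_conj.comp
        (contDiff_nullChi (n := 0) hq contDiff_fst contDiff_snd).continuous).add
        (continuous_const.mul (Complex.continuous_conj.comp
          (contDiff_anglePotential (n := 0) hq contDiff_fst contDiff_snd).continuous))))

theorem continuous_sphereDensity (hq : q ≠ 0) :
    Continuous fun p : ℝ × ℝ => sphereDensity q p.1 p.2 :=
  (continuous_radialDensity hq).add (continuous_angularDensity hq)

theorem continuous_nullCoord (α : ℝ) : Continuous (nullCoord α) :=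
  (contDiff_nullCoord (n := 0) α).continuous

theorem integrableOn_mul_comp_nullCoord {G : ℝ × ℝ → ℝ} (hG : Continuous G) {k : ℝ → ℝ} {s : Set ℝ}
    (hk : IntegrableOn k s) (t : ℝ) :
    IntegrableOn (fun ρ => k ρ * G (nullCoord α (t + ρ), nullCoord α (t - ρ))) s := by
  obtain ⟨C, hC⟩ := (isCompact_Icc.prod isCompact_Icc).exists_bound_of_continuousOn
    (s := Icc (-1 : ℝ) 1 ×ˢ Icc (-1 : ℝ) 1) hG.continuousOn
  have hcoord : Continuous fun ρ => (nullCoord α (t + ρ), nullCoord α (t - ρ)) :=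
    ((continuous_nullCoord α).comp (by fun_prop)).prodMk
      ((continuous_nullCoord α).comp (by fun_prop))
  exact Integrable.mul_bdd (c := C) hk (hG.comp hcoord).aestronglyMeasurable
    (Eventually.of_forall fun ρ => hC _ ⟨Ioo_subset_Icc_self (nullCoord_mem_Ioo α _),
      Ioo_subset_Icc_self (nullCoord_mem_Ioo α _)⟩)

theorem integrableOn_nullDeriv_add_mul (hα : 0 < α) {G : ℝ × ℝ → ℝ} (hG : Continuous G) (t : ℝ) :
    IntegrableOn
      (fun ρ => nullDeriv α (t + ρ) * G (nullCoord α (t + ρ), nullCoord α (t - ρ))) (Ioi 0) :=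
  integrableOn_mul_comp_nullCoord hG (integrableOn_nullDeriv_add hα t 0) t

theorem integrableOn_nullDeriv_sub_mul (hα : 0 < α) {G : ℝ × ℝ → ℝ} (hG : Continuous G) (t : ℝ) :
    IntegrableOn
      (fun ρ => nullDeriv α (t - ρ) * G (nullCoord α (t - ρ), nullCoord α (t + ρ))) (Ioi 0) :=
  integrableOn_mul_comp_nullCoord (hG.comp continuous_swap) (integrableOn_nullDeriv_sub hα t 0) t

theorem integrableOn_mul_angle {k w : ℝ → ℝ} (hk : IntegrableOn k (Ioi 0)) (hw : Continuous w) :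
    IntegrableOn (fun p : ℝ × ℝ × ℝ => k p.1 * w p.2.1)
      (Ioi 0 ×ˢ (Ioo 0 π ×ˢ Ioo 0 (2 * π))) := by
  have hangle : IntegrableOn (fun p : ℝ × ℝ => w p.1) (Ioo 0 π ×ˢ Ioo 0 (2 * π)) :=
    ((hw.comp continuous_fst).continuousOn.integrableOn_compact
      (isCompact_Icc.prod isCompact_Icc)).mono_set
        (prod_mono Ioo_subset_Icc_self Ioo_subset_Icc_self)
  have hprod := hk.integrable.mul_prod hangle.integrable
  rwa [Measure.prod_restrict] at hprod

theorem integrableOn_mul_nullCurrent {k v u ψ : ℝ → ℝ} (hψ : Continuous ψ)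
    (hradial : IntegrableOn (fun ρ => k ρ * radialDensity q (v ρ) (u ρ)) (Ioi 0))
    (hangular : IntegrableOn (fun ρ => k ρ * angularDensity q (v ρ) (u ρ)) (Ioi 0)) :
    IntegrableOn (fun p : ℝ × ℝ × ℝ => k p.1 * nullCurrent q (v p.1) (u p.1) (ψ p.2.1))
      (Ioi 0 ×ˢ (Ioo 0 π ×ˢ Ioo 0 (2 * π))) := by
  refine ((integrableOn_mul_angle hradial (w := fun θ => 2 * sin (ψ θ) ^ 3) (by fun_prop)).add
    (integrableOn_mul_angle hangular (w := fun θ => sin (ψ θ) * (1 - cos (ψ θ)) ^ 2)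
      (by fun_prop))).congr (Eventually.of_forall fun p => ?_)
  simp only [Pi.add_apply, nullCurrent]
  ring

theorem integrableOn_hopfionCurrent_zero (hα : 0 < α) (hb : b ≠ 0) (t : ℝ) :
    IntegrableOn (fun p : ℝ × ℝ × ℝ => hopfionCurrent α b t p.1 p.2.1 p.2.2 0)
      (Ioi 0 ×ˢ (Ioo 0 π ×ˢ Ioo 0 (2 * π))) := by
  have hq := mul_ne_zero hb hα.ne'
  have hplus := integrableOn_mul_nullCurrent continuous_id
    (integrableOn_nullDeriv_add_mul hα (continuous_radialDensity hq) t)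
    (integrableOn_nullDeriv_add_mul hα (continuous_angularDensity hq) t)
  have hminus := integrableOn_mul_nullCurrent (ψ := fun θ => π - θ) (by fun_prop)
    (integrableOn_nullDeriv_sub_mul hα (continuous_radialDensity hq) t)
    (integrableOn_nullDeriv_sub_mul hα (continuous_angularDensity hq) t)
  refine IntegrableOn.congr_fun ((hplus.add hminus).const_mul (-(α ^ 4 / (8 * π))))
    (fun p hp => (hopfionCurrent_zero_eq (mul_ne_zero hα.ne' hb) t (ne_of_gt hp.1)
      (sin_nonneg_of_mem_Icc (Ioo_subset_Icc_self hp.2.1)) p.2.2).symm)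
    (measurableSet_Ioi.prod (measurableSet_Ioo.prod measurableSet_Ioo))

theorem integrableOn_hopfionCurrent_one (h : α * b ≠ 0) (t : ℝ) {ρ : ℝ} (hρ : ρ ≠ 0) :
    IntegrableOn (fun p : ℝ × ℝ => hopfionCurrent α b t ρ p.1 p.2 1)
      (Ioo 0 π ×ˢ Ioo 0 (2 * π)) := by
  refine IntegrableOn.congr_fun ?_ (fun p hp => (hopfionCurrent_one_eq h t hρ
    (sin_nonneg_of_mem_Icc (Ioo_subset_Icc_self hp.1)) p.2).symm)
    (measurableSet_Ioo.prod measurableSet_Ioo)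
  unfold nullCurrent
  exact ((Continuous.continuousOn (by fun_prop)).integrableOn_compact
    (isCompact_Icc.prod isCompact_Icc)).mono_set
      (prod_mono Ioo_subset_Icc_self Ioo_subset_Icc_self)

theorem tendsto_const_sub_atTop_atBot (t : ℝ) : Tendsto (fun ρ => t - ρ) atTop atBot :=
  tendsto_atBot_add_const_left _ t tendsto_neg_atTop_atBot

theorem tendsto_nullCoord_add_sub (hα : 0 < α) (t : ℝ) :
    Tendsto (fun ρ => (nullCoord α (t + ρ), nullCoord α (t - ρ))) atTop (𝓝 (1, -1)) :=
  ((tendsto_nullCoord_atTop hα).comp (tendsto_atTop_add_const_left _ t tendsto_id)).prodMk_nhds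
    ((tendsto_nullCoord_atBot hα).comp (tendsto_const_sub_atTop_atBot t))

theorem tendsto_helicityFlux (hα : 0 < α) (hb : b ≠ 0) (t : ℝ) :
    Tendsto (fun ρ => helicityFlux α b t ρ) atTop (𝓝 0) := by
  have hq := mul_ne_zero hb hα.ne'
  have hcoord := tendsto_nullCoord_add_sub hα t
  have hplus := ((tendsto_nullDeriv_atTop hα).comp
    (tendsto_atTop_add_const_left _ t tendsto_id)).mul
      (((continuous_sphereDensity hq).tendsto _).comp hcoord)
  have hminus := ((tendsto_nullDeriv_atBot hα).comp
    (tendsto_const_sub_atTop_atBot t)).mul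
      ((((continuous_sphereDensity hq).comp continuous_swap).tendsto _).comp hcoord)
  have hflux := ((hplus.sub hminus).const_mul (2 / 3 * α ^ 4)).neg
  simp only [zero_mul, sub_zero, mul_zero, neg_zero] at hflux
  refine hflux.congr' ?_
  filter_upwards [eventually_ne_atTop 0] with ρ hρ
  rw [helicityFlux, integral_sphere_hopfionCurrent_one (mul_ne_zero hα.ne' hb) t hρ]
  rfl

end Integrability

/-- A potential for the helicity current averaged over spheres: as a function of the null
coordinates, the averaged current is proportional to its differential
(see `hasDerivAt_helicityPotential`). The difference of arctangents is the phase of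
`pole q v / pole q u`. -/
def helicityPotential (q v u : ℝ) : ℝ :=
  -(2 / 3) * (nullChi q v u * (starRingEnd ℂ) (anglePotential q v u)).re
    + 1 / (6 * q ^ 4) * ∫ ψ in (0 : ℝ)..(arctan (v / q) - arctan (u / q)), sin ψ ^ 4

section HelicityPotential

variable {α b q : ℝ}

theorem sin_arctan_sub_arctan_sq (x y : ℝ) :
    sin (arctan x - arctan y) ^ 2 = (x - y) ^ 2 / ((1 + x ^ 2) * (1 + y ^ 2)) := by
  have hx : 0 < 1 + x ^ 2 := by positivity
  have hy : 0 < 1 + y ^ 2 := by positivity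
  have hcross : sin (arctan x - arctan y) = (x - y) * (1 / √(1 + x ^ 2) * (1 / √(1 + y ^ 2))) := by
    rw [sin_sub, sin_arctan, cos_arctan, sin_arctan, cos_arctan]
    ring
  rw [hcross, mul_pow, mul_pow, div_pow, div_pow, sq_sqrt hx.le, sq_sqrt hy.le]
  field_simp

theorem im_nullChiDeriv_mul_conj_nullChi (hq : q ≠ 0) (v u : ℝ) :
    (nullChiDeriv q v u * (starRingEnd ℂ) (nullChi q v u)).im
      = -(q * (v - u) ^ 4 / (8 * (q ^ 2 + v ^ 2) ^ 3 * (q ^ 2 + u ^ 2) ^ 2)) := by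
  have hv := pole_ne_zero hq v
  have hu := pole_ne_zero hq u
  have hnorm (w : ℝ) : pole q w * (starRingEnd ℂ) (pole q w) = ((q ^ 2 + w ^ 2 : ℝ) : ℂ) := by
    rw [Complex.mul_conj, pole, mul_comm Complex.I, Complex.normSq_add_mul_I]
  have hconj (w : ℝ) : (starRingEnd ℂ) (pole q w) = (q ^ 2 + w ^ 2 : ℝ) / pole q w :=
    eq_div_of_mul_eq (pole_ne_zero hq w) (mul_comm _ (pole q w) ▸ hnorm w)
  have hV : ((q ^ 2 + v ^ 2 : ℝ) : ℂ) ≠ 0 := by exact_mod_cast (by positivity)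
  have hU : ((q ^ 2 + u ^ 2 : ℝ) : ℂ) ≠ 0 := by exact_mod_cast (by positivity)
  have hdiff : pole q v - pole q u = Complex.I * ((v - u : ℝ) : ℂ) := by
    simp only [pole, Complex.ofReal_sub]
    ring
  have hprod : nullChiDeriv q v u * (starRingEnd ℂ) (nullChi q v u)
      = (((v - u) ^ 3 / (8 * (q ^ 2 + v ^ 2) ^ 3 * (q ^ 2 + u ^ 2) ^ 2) : ℝ) : ℂ)
        * ((starRingEnd ℂ) (pole q v) * pole q u) := by
    rw [nullChi_eq_div hq, nullChiDeriv, div_sub_div _ _ hu hv, one_mul, mul_one, hdiff]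
    simp only [map_div₀, map_pow, map_mul, Complex.conj_ofReal, hconj]
    push_cast at hV hU ⊢
    field_simp
    simp only [Complex.I_sq]
    ring
  rw [hprod, Complex.im_ofReal_mul]
  simp only [pole, map_add, map_mul, Complex.conj_ofReal, Complex.conj_I, Complex.mul_im,
    Complex.mul_re, Complex.add_im, Complex.add_re, Complex.neg_im, Complex.neg_re, Complex.I_im,
    Complex.I_re, Complex.ofReal_im, Complex.ofReal_re]
  ring

section Derivatives

variable {v u : ℝ → ℝ} {v' u' s : ℝ}

theorem hasDerivAt_re_nullChi_mul_conj_anglePotential (hq : q ≠ 0) (hv : HasDerivAt v v' s)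
    (hu : HasDerivAt u u' s) :
    HasDerivAt
      (fun s => (nullChi q (v s) (u s) * (starRingEnd ℂ) (anglePotential q (v s) (u s))).re)
      ((sphereDensity q (v s) (u s)
          - 2 * (nullChiDeriv q (v s) (u s) * (starRingEnd ℂ) (nullChi q (v s) (u s))).im) * v'
        - (sphereDensity q (u s) (v s)
          - 2 * (nullChiDeriv q (u s) (v s) * (starRingEnd ℂ) (nullChi q (u s) (v s))).im) * u')
      s := by
  have hconj := Complex.conjCLE.toContinuousLinearMap.hasFDerivAt.comp_hasDerivAt s
    (hasDerivAt_anglePotential hq hv hu)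
  refine (Complex.reCLM.hasFDerivAt.comp_hasDerivAt s
    ((hasDerivAt_nullChi hq hv hu).mul hconj)).congr_deriv ?_
  simp only [sphereDensity, radialDensity, angularDensity]
  rw [nullChi_comm q (v s), anglePotential_comm q (v s)]
  simp
  ring

theorem hasDerivAt_integral_sin_pow_four (hq : q ≠ 0) (hv : HasDerivAt v v' s)
    (hu : HasDerivAt u u' s) :
    HasDerivAt (fun s => ∫ ψ in (0 : ℝ)..(arctan (v s / q) - arctan (u s / q)), sin ψ ^ 4)
      (q ^ 4 * (v s - u s) ^ 4 / ((q ^ 2 + v s ^ 2) ^ 2 * (q ^ 2 + u s ^ 2) ^ 2)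
        * (q / (q ^ 2 + v s ^ 2) * v' - q / (q ^ 2 + u s ^ 2) * u')) s := by
  have hphase := (hv.div_const q).arctan.sub (hu.div_const q).arctan
  refine (((continuous_sin.pow 4).integral_hasStrictDerivAt 0 _).hasDerivAt.comp s
    hphase).congr_deriv ?_
  have hsin : sin (arctan (v s / q) - arctan (u s / q)) ^ 4
      = (sin (arctan (v s / q) - arctan (u s / q)) ^ 2) ^ 2 := by ring
  simp only [Pi.pow_apply, Pi.sub_apply]
  rw [hsin, sin_arctan_sub_arctan_sq]
  field_simp

theorem hasDerivAt_helicityPotential (hq : q ≠ 0) (hv : HasDerivAt v v' s)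
    (hu : HasDerivAt u u' s) :
    HasDerivAt (fun s => helicityPotential q (v s) (u s))
      (-(2 / 3) * (sphereDensity q (v s) (u s) * v' - sphereDensity q (u s) (v s) * u')) s := by
  refine (((hasDerivAt_re_nullChi_mul_conj_anglePotential hq hv hu).const_mul (-(2 / 3))).add
    ((hasDerivAt_integral_sin_pow_four hq hv hu).const_mul (1 / (6 * q ^ 4)))).congr_deriv ?_
  rw [im_nullChiDeriv_mul_conj_nullChi hq, im_nullChiDeriv_mul_conj_nullChi hq]
  field_simp
  ring

end Derivatives

theorem continuous_helicityPotential (hq : q ≠ 0) :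
    Continuous fun p : ℝ × ℝ => helicityPotential q p.1 p.2 := by
  have hchi := (contDiff_nullChi (n := 0) hq contDiff_fst contDiff_snd).continuous
  have hangle := (contDiff_anglePotential (n := 0) hq contDiff_fst contDiff_snd).continuous
  have hprimitive := (intervalIntegral.continuous_primitive (μ := volume)
    (f := fun ψ => sin ψ ^ 4) (fun _ _ => ((continuous_sin.pow 4).intervalIntegrable _ _)) 0).comp
      (by fun_prop : Continuous fun p : ℝ × ℝ => arctan (p.1 / q) - arctan (p.2 / q))
  exact (continuous_const.mul (Complex.continuous_re.comp
    (hchi.mul (Complex.continuous_conj.comp hangle)))).add (continuous_const.mul hprimitive)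

theorem helicityPotential_self (q w : ℝ) : helicityPotential q w w = 0 := by
  simp [helicityPotential, nullChi]

theorem sin_two_mul_arctan (x : ℝ) : sin (2 * arctan x) = 2 * x / (1 + x ^ 2) := by
  rw [sin_two_mul, ← tan_mul_cos (cos_arctan_pos x).ne', tan_arctan, mul_assoc, mul_assoc, ← sq,
    cos_sq_arctan]
  ring

theorem cos_two_mul_arctan (x : ℝ) : cos (2 * arctan x) = (1 - x ^ 2) / (1 + x ^ 2) := by
  rw [cos_two_mul, cos_sq_arctan]
  field_simp
  ring

theorem integral_sin_pow_four_two_mul_arctan (x : ℝ) :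
    ∫ ψ in (0 : ℝ)..(2 * arctan x), sin ψ ^ 4
      = 3 / 4 * arctan x - 3 / 4 * x * (1 - x ^ 2) / (1 + x ^ 2) ^ 2
        - 2 * x ^ 3 * (1 - x ^ 2) / (1 + x ^ 2) ^ 4 := by
  have hreduction := integral_sin_pow (a := 0) (b := 2 * arctan x) 2
  rw [integral_sin_sq, sin_two_mul_arctan, cos_two_mul_arctan] at hreduction
  norm_num at hreduction
  rw [hreduction]
  field_simp
  ring

theorem helicityPotential_one_neg_one (hq : q ≠ 0) :
    helicityPotential q 1 (-1)
      = 1 / (8 * q ^ 4) * (arctan (1 / q) + q * (1 - q ^ 2) / (1 + q ^ 2) ^ 2) := by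
  have hprod : pole q 1 * pole q (-1) = ((1 + q ^ 2 : ℝ) : ℂ) := by
    simp [pole]
    linear_combination -Complex.I_sq
  have hsum : pole q 1 + pole q (-1) = ((2 * q : ℝ) : ℂ) := by
    simp [pole]
    ring
  have hchi : nullChi q 1 (-1) = ((1 / (1 + q ^ 2) ^ 2 : ℝ) : ℂ) := by
    rw [nullChi_eq_div hq, hprod]
    norm_num
  have hangle : anglePotential q 1 (-1)
      = (((1 - q ^ 2) / (2 * q * (1 + q ^ 2) ^ 2) : ℝ) : ℂ) := by
    have hdiff : pole q 1 - pole q (-1) = Complex.I * 2 := by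
      simp [pole]
      ring
    have hsq : pole q 1 ^ 2 + pole q (-1) ^ 2 = ((2 * q ^ 2 - 2 : ℝ) : ℂ) := by
      simp [pole]
      linear_combination 2 * Complex.I_sq
    rw [anglePotential, mul_assoc 4, ← mul_pow, hdiff, hsq, hprod, hsum, ← mul_assoc Complex.I,
      Complex.I_mul_I]
    have hreal : -1 * 2 * (2 * q ^ 2 - 2) / (4 * (1 + q ^ 2) ^ 2 * (2 * q))
        = (1 - q ^ 2) / (2 * q * (1 + q ^ 2) ^ 2) := by
      field_simp
      ring
    exact_mod_cast congrArg Complex.ofReal hreal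
  rw [helicityPotential, hchi, hangle, Complex.conj_ofReal, ← Complex.ofReal_mul,
    Complex.ofReal_re, neg_div, arctan_neg, sub_neg_eq_add, ← two_mul,
    integral_sin_pow_four_two_mul_arctan]
  field_simp
  ring

theorem totalHelicity_eq (hα : 0 < α) (hb : b ≠ 0) (t : ℝ) :
    totalHelicity α b t = helicityValue α b := by
  have hq := mul_ne_zero hb hα.ne'
  have hderiv (ρ : ℝ) := (hasDerivAt_helicityPotential hq
    ((hasDerivAt_nullCoord α (t + ρ)).comp_const_add t ρ)
    ((hasDerivAt_nullCoord α (t - ρ)).comp_const_sub t ρ)).const_mul (α ^ 4)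
  have hlim := (((continuous_helicityPotential hq).tendsto (1, -1)).comp
    (tendsto_nullCoord_add_sub hα t)).const_mul (α ^ 4)
  have hint := ((integrableOn_nullDeriv_add_mul hα (continuous_sphereDensity hq) t).add
    (integrableOn_nullDeriv_sub_mul hα (continuous_sphereDensity hq) t)).const_mul
      (-(2 / 3) * α ^ 4)
  have hFTC := integral_Ioi_of_hasDerivAt_of_tendsto'
    (fun ρ _ => (hderiv ρ).congr_deriv (by simp only [Pi.add_apply]; ring)) hint hlim
  simp only [Pi.add_apply] at hFTC
  rw [totalHelicity, setIntegral_congr_fun measurableSet_Ioi fun ρ (hρ : 0 < ρ) =>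
    integral_sphere_hopfionCurrent_zero (mul_ne_zero hα.ne' hb) t hρ.ne']
  rw [hFTC, add_zero, sub_zero, helicityPotential_self, helicityPotential_one_neg_one hq,
    helicityValue, mul_comm α b]
  field_simp
  ring

end HelicityPotential

section FlatLimit

variable {b : ℝ}

theorem abs_arctan_sub_self_le (x : ℝ) : |arctan x - x| ≤ |x| ^ 3 := by
  have hbound : ∀ y ∈ uIcc 0 x, ‖1 / (1 + y ^ 2) - 1‖ ≤ |x| ^ 2 := fun y hy => by
    have hyx : |y| ≤ |x| := by simpa using abs_sub_left_of_mem_uIcc hy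
    calc ‖1 / (1 + y ^ 2) - 1‖ = y ^ 2 / (1 + y ^ 2) := by
          rw [norm_eq_abs, ← abs_neg, ← abs_of_nonneg (a := y ^ 2 / (1 + y ^ 2)) (by positivity)]
          congr 1
          field_simp
          ring
      _ ≤ y ^ 2 := div_le_self (sq_nonneg y) (by linarith [sq_nonneg y])
      _ ≤ |x| ^ 2 := by rw [sq_abs]; exact sq_le_sq.2 hyx
  simpa [pow_succ] using (convex_uIcc 0 x).norm_image_sub_le_of_norm_hasDerivWithin_le
    (fun y _ => ((hasDerivAt_arctan y).sub (hasDerivAt_id y)).hasDerivWithinAt) hbound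
    left_mem_uIcc right_mem_uIcc

theorem isBigO_arctan_sub_self : (fun x : ℝ => arctan x - x) =O[𝓝 0] fun x => x ^ 3 :=
  IsBigO.of_bound' (Eventually.of_forall fun x => by
    simpa only [norm_eq_abs, abs_pow] using abs_arctan_sub_self_le x)

theorem arctan_one_div {x : ℝ} (hx : x ≠ 0) : arctan (1 / x) = π / 2 * sign x - arctan x := by
  rw [one_div]
  rcases hx.lt_or_gt with hneg | hpos
  · rw [arctan_inv_of_neg hneg, sign_of_neg hneg]
    ring
  · rw [arctan_inv_of_pos hpos, sign_of_pos hpos]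
    ring

theorem sign_mul_of_pos {a : ℝ} (ha : 0 < a) (b : ℝ) : sign (a * b) = sign b := by
  rcases lt_trichotomy b 0 with hneg | rfl | hpos
  · rw [sign_of_neg hneg, sign_of_neg (mul_neg_of_pos_of_neg ha hneg)]
  · rw [mul_zero]
  · rw [sign_of_pos hpos, sign_of_pos (mul_pos ha hpos)]

theorem helicityValue_sub_flat {α : ℝ} (hα : 0 < α) (hb : b ≠ 0) :
    helicityValue α b - π * Real.sign b / (16 * b ^ 4)
      = 1 / (8 * b ^ 4) * (-(arctan (α * b) - α * b)
        - (α * b) ^ 3 * ((3 + (α * b) ^ 2) / (1 + (α * b) ^ 2) ^ 2)) := by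
  rw [helicityValue, arctan_one_div (mul_ne_zero hα.ne' hb), sign_mul_of_pos hα]
  field_simp
  ring

theorem isBigO_totalHelicity_sub_flat (hb : b ≠ 0) (t : ℝ) :
    (fun α => totalHelicity α b t - π * Real.sign b / (16 * b ^ 4))
      =O[𝓝[>] 0] fun α => α ^ 3 := by
  have hrational : (fun x : ℝ => x ^ 3 * ((3 + x ^ 2) / (1 + x ^ 2) ^ 2))
      =O[𝓝 0] fun x => x ^ 3 := by
    have hcont : ContinuousAt (fun x : ℝ => (3 + x ^ 2) / (1 + x ^ 2) ^ 2) 0 :=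
      ContinuousAt.div (by fun_prop) (by fun_prop) (by norm_num)
    simpa using (isBigO_refl (fun x : ℝ => x ^ 3) (𝓝 0)).mul (hcont.isBigO_one ℝ)
  have hscale : Tendsto (fun α : ℝ => α * b) (𝓝[>] 0) (𝓝 0) :=
    ((continuous_mul_const b).tendsto' 0 0 (zero_mul b)).mono_left nhdsWithin_le_nhds
  have hcubic : (fun α : ℝ => (α * b) ^ 3) =O[𝓝[>] 0] fun α => α ^ 3 := by
    simpa only [mul_pow, mul_comm _ (b ^ 3)] using
      (isBigO_refl (fun α : ℝ => α ^ 3) _).const_mul_left (b ^ 3)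
  refine ((((isBigO_arctan_sub_self.neg_left.sub hrational).comp_tendsto hscale).trans
    hcubic).const_mul_left (1 / (8 * b ^ 4))).congr' ?_ EventuallyEq.rfl
  filter_upwards [self_mem_nhdsWithin] with α hα
  rw [totalHelicity_eq hα hb, helicityValue_sub_flat hα hb]
  rfl

end FlatLimit

end

end DeSitterHopfion

theorem mainTheorem7 (b : ℝ) (hb : b ≠ 0) :
    (∀ α : ℝ, 0 < α →
      -- the potential is smooth and `𝓕_H = d𝓐_H`
      ContDiffOn ℝ ∞ (DeSitterHopfion.hopfionA α b) DeSitterHopfion.chart ∧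
      (∀ x ∈ DeSitterHopfion.chart,
        DeSitterHopfion.extD (DeSitterHopfion.hopfionA α b) x = DeSitterHopfion.hopfionF α b x) ∧
      -- the total helicity: finiteness, closed form, independence of time
      (∀ t : ℝ,
        IntegrableOn
          (fun p : ℝ × ℝ × ℝ => DeSitterHopfion.hopfionCurrent α b t p.1 p.2.1 p.2.2 0)
          (Ioi 0 ×ˢ (Ioo 0 π ×ˢ Ioo 0 (2 * π))) ∧
        DeSitterHopfion.totalHelicity α b t = DeSitterHopfion.helicityValue α b ∧
        HasDerivAt (fun s => DeSitterHopfion.totalHelicity α b s) 0 t ∧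
        -- the flux through the cosmological horizon
        (∀ ρ : ℝ, 0 < ρ →
          IntegrableOn (fun p : ℝ × ℝ => DeSitterHopfion.hopfionCurrent α b t ρ p.1 p.2 1)
            (Ioo 0 π ×ˢ Ioo 0 (2 * π))) ∧
        Tendsto (fun ρ => DeSitterHopfion.helicityFlux α b t ρ) atTop (𝓝 0))) ∧
    -- the flat limit
    (∀ t : ℝ,
      Tendsto (fun α => DeSitterHopfion.totalHelicity α b t) (𝓝[>] 0)
        (𝓝 (π * Real.sign b / (16 * b ^ 4))) ∧
      (fun α => DeSitterHopfion.totalHelicity α b t - π * Real.sign b / (16 * b ^ 4))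
        =O[𝓝[>] 0] (fun α => α ^ 3)) := by
  refine ⟨fun α hα => ?_, fun t => ⟨?_, DeSitterHopfion.isBigO_totalHelicity_sub_flat hb t⟩⟩
  · have hαb := mul_ne_zero hα.ne' hb
    refine ⟨(DeSitterHopfion.contDiff_hopfionA hαb).contDiffOn,
      fun x hx => DeSitterHopfion.extD_hopfionA hαb hx.1.ne', fun t =>
      ⟨DeSitterHopfion.integrableOn_hopfionCurrent_zero hα hb t,
        DeSitterHopfion.totalHelicity_eq hα hb t, ?_,
        fun ρ hρ => DeSitterHopfion.integrableOn_hopfionCurrent_one hαb t hρ.ne',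
        DeSitterHopfion.tendsto_helicityFlux hα hb t⟩⟩
    simp only [DeSitterHopfion.totalHelicity_eq hα hb]
    exact hasDerivAt_const _ _
  · have hcube : Tendsto (fun α : ℝ => α ^ 3) (𝓝[>] 0) (𝓝 0) :=
      ((continuous_pow 3).tendsto' 0 0 (zero_pow three_ne_zero)).mono_left nhdsWithin_le_nhds
    exact tendsto_sub_nhds_zero_iff.mp
      ((DeSitterHopfion.isBigO_totalHelicity_sub_flat hb t).trans_tendsto hcube)
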